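/- Let $\gamma\ge 1$, $p(\rho)=\rho^\gamma$, $c=\sqrt{p'(\rho)}$, and $\pi(\rho)=\log\rho$ if $\gamma=1$, $\pi(\rho)=\frac{\gamma}{\gamma-1}\rho^{\gamma-1}$ if $\gamma>1$ (so $\pi'=\rho^{-1}c^2$). A self-similar potential flow in the similarity coordinates $\xi=x/t\in\mathbb R^2$ has a potential $\psi$, velocity $v=\nabla\psi$, pseudo-velocity $z=v-\xi=\nabla\chi$ with $\chi=\psi-\frac12|\xi|^2$, and density $\rho>0$ given by $\pi(\rho)=-\chi-\frac12|z|^2$; it is a weak solution of $\nabla\cdot(\rho\nabla\chi)+2\rho=0$. It is elliptic where $|z|<c$. A constant state is an affine $\psi$. At walls with normal $n$ the slip condition $z\cdot n=0$ holds. At a shock with unit normal $n$ pointing downstream, $\psi_u=\psi_d$, $\rho_u z_u\cdot n=\rho_d z_d\cdot n$ and $z_u\cdot n>z_d\cdot n>0$ ($u$: upstream, $d$: downstream). For a constant upstream state $\psi^I,v^I,\rho^I$ put $$g(v,\xi)=\Big(\pi^{-1}\big[-(\psi^I(\xi)-\tfrac12|\xi|^2)-\tfrac12|v-\xi|^2\big](v-\xi)-\rho^I(v^I-\xi)\Big)\cdot\frac{v^I-v}{|v^I-v|};$$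 a shock with downstream velocity $v$ is strong-type at $\xi$ if $g_v(v,\xi)\cdot(v-\xi)>0$. In both settings below, $E$ is a bounded, open, connected region; $\psi\in C^1(\overline E)$ with $\rho>0$ on $\overline E$ is a weak solution in $E$; $S$ is a simple regular curve that starts at the reflection point $\xi_r$ on the reflection wall $A$, is $C^1$ up to and including both endpoints, and has $E$ on its downstream side and a constant state $I$ on its upstream side, the shock conditions holding on $\overline S$; $A_E$ is the open segment of $A$ that bounds $E$, with the slip condition on it. The flow is elliptic in $E$, on $A_E$, on $S$ and at $\xi_r$ (the shock is transonic). (1) Classical regular reflection. The flow domain is a convex corner between the walls $A$ and $B$ (opening angle in $(0,\pi)$). A straight incident shock runs in the flow domain, outside $\overline E$, from $\xi_r\in A$ to infinity; upstream of it is a constant state adjacent to the rest of $A$, downstream of it the constant state $I$, which is also adjacent to the part of $B$ beyond the endpoint $\xi_b\in B$ of $S$; both satisfy the slip condition there. $S$ runs from $\xi_r$ to $\xi_b$ inside the flow domain, and $E$ is the region enclosed by $S$ and the two wall segments from the corner to $\xi_r$ and to $\xi_b$; the slip condition also holds on the segment of $B$ bounding $E$. Let $n_B$ be the normal of $B$ outer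 to $E$, and suppose that in the frame of reference in which $v(\xi_r)=0$ the angle between $v^I$ and $n_B$ is not $90^\circ$, that is, $\measuredangle(v^I-v(\xi_r),n_B)\ne 90^\circ$. (2) Supersonic flow onto a wedge. $A$ is a ray from the wedge tip $\xi_r$ in direction $a$. As seen from the tip, the upstream velocity $v^I-\xi_r$ is supersonic and directed onto the wedge at an angle in $(0^\circ,90^\circ)$ to $a$. The region downstream of the shock, on the flow side of $A$, consists of $E$ and a region $H$ carrying a constant state $\psi_H$ with velocity $v_H$ and sound speed $c_H$. The shock is the curve $S$ from $\xi_r$ to a point $\xi_p$, continued in a $C^1$ way by a straight ray from $\xi_p$ in direction $a$, on which the shock conditions hold between $I$ and $\psi_H$. $H$ is the unbounded region between this ray and $A$, outside the circle $|\xi-v_H|=c_H$, with $(\xi-v_H)\cdot a>0$. $E$ is enclosed by $S$, a segment of $A$ starting at $\xi_r$, and the arc $P$ of that circle that separates it from $H$. $\psi=\psi_H$ in $H$, $\psi_H$ satisfies the slip condition on its part of $A$, and $\psi\in C^1(\overline{E\cup H})$. Then in neither setting can the reflected shock be strong-type at $\xi_r$: no global regular reflection with transonic strong-type reflected shock exists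 in this class. -/

import Mathlib

noncomputable section

/-- The plane of similarity coordinates `ξ = x / t` (and of velocities). -/
abbrev Plane : Type := EuclideanSpace ℝ (Fin 2)

/-! ### Polytropic gas: `p(ρ) = ρ ^ γ` -/

/-- The polytropic pressure law. -/
def pressure (γ ρ : ℝ) : ℝ := ρ ^ γ

/-- The sound speed `c = √(dp/dρ)`. -/
def soundSpeed (γ ρ : ℝ) : ℝ := Real.sqrt (deriv (pressure γ) ρ)

/-- The function `π(ρ)` with `dπ/dρ = ρ⁻¹ dp/dρ = ρ⁻¹ c²` (see `hasDerivAt_enthalpy`). -/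
def enthalpy (γ ρ : ℝ) : ℝ :=
  if γ = 1 then Real.log ρ else γ / (γ - 1) * ρ ^ (γ - 1)

/-- The inverse function `π⁻¹`, meaningful on the range `π (0, ∞)` (see `density_enthalpy`). -/
def density (γ s : ℝ) : ℝ :=
  if γ = 1 then Real.exp s else ((γ - 1) / γ * s) ^ (1 / (γ - 1))

theorem hasDerivAt_enthalpy {γ ρ : ℝ} (hρ : 0 < ρ) :
    HasDerivAt (enthalpy γ) (ρ⁻¹ * deriv (pressure γ) ρ) ρ := by
  have hp : deriv (pressure γ) ρ = γ * ρ ^ (γ - 1) :=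
    (Real.hasDerivAt_rpow_const (Or.inl hρ.ne')).deriv
  rw [hp]
  by_cases h : γ = 1
  · subst h
    have he : enthalpy 1 = Real.log := by
      funext x
      simp [enthalpy]
    rw [he]
    simpa using Real.hasDerivAt_log hρ.ne'
  · have he : enthalpy γ = fun x => γ / (γ - 1) * x ^ (γ - 1) := by
      funext x
      simp [enthalpy, h]
    rw [he]
    have hγ : γ - 1 ≠ 0 := sub_ne_zero.mpr h
    have hd := (Real.hasDerivAt_rpow_const (p := γ - 1) (Or.inl hρ.ne')).const_mul (γ / (γ - 1))
    have e : ρ⁻¹ * (γ * ρ ^ (γ - 1)) = γ / (γ - 1) * ((γ - 1) * ρ ^ (γ - 1 - 1)) := by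
      rw [Real.rpow_sub_one hρ.ne' (γ - 1)]
      field_simp
    rw [e]
    exact hd

theorem density_enthalpy {γ ρ : ℝ} (hγ : 1 ≤ γ) (hρ : 0 < ρ) :
    density γ (enthalpy γ ρ) = ρ := by
  by_cases h : γ = 1
  · simp [density, enthalpy, h, Real.exp_log hρ]
  · have h1 : γ - 1 ≠ 0 := sub_ne_zero.mpr h
    have h0 : γ ≠ 0 := by linarith
    have h2 : (γ - 1) / γ * (γ / (γ - 1) * ρ ^ (γ - 1)) = ρ ^ (γ - 1) := by
      field_simp
    simp only [density, enthalpy, h, if_false]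
    rw [h2, ← Real.rpow_mul hρ.le, mul_one_div_cancel h1, Real.rpow_one]

/-! ### Self-similar potential flow

A flow is described by the values of its potential `ψ` and of its velocity `v = ∇ψ`.  At a point `ξ`
the pseudo-velocity is `z = ∇χ = v - ξ`, where `χ = ψ - |ξ|² / 2` is the pseudo-potential. -/

/-- `-χ - |∇χ|² / 2`, the quantity that equals `π(ρ)`, at a point `ξ` where the potential has the
value `u` and the velocity is `v`. -/
def enthalpyAt (u : ℝ) (v ξ : Plane) : ℝ := -(u - ‖ξ‖ ^ 2 / 2) - ‖v - ξ‖ ^ 2 / 2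

/-- The density at `ξ`, given the value `u` of the potential and the velocity `v`. -/
def flowDensity (γ u : ℝ) (v ξ : Plane) : ℝ := density γ (enthalpyAt u v ξ)

/-- There is a (positive) density at `ξ`, given the value `u` of the potential and the
velocity `v`. -/
def HasPositiveDensity (γ u : ℝ) (v ξ : Plane) : Prop :=
  enthalpyAt u v ξ ∈ enthalpy γ '' Set.Ioi 0

/-- The flow is elliptic (pseudo-subsonic) at `ξ`: the pseudo-Mach number `|z| / c` is `< 1`. -/
def IsPseudoSubsonic (γ u : ℝ) (v ξ : Plane) : Prop :=
  ‖v - ξ‖ < soundSpeed γ (flowDensity γ u v ξ)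

/-- A constant state: an affine potential `ψ(ξ) = k + v · ξ`. -/
structure ConstState where
  k : ℝ
  v : Plane

namespace ConstState

/-- The potential of a constant state. -/
def potential (U : ConstState) (ξ : Plane) : ℝ := U.k + inner ℝ U.v ξ

theorem enthalpyAt_eq (U : ConstState) (ξ : Plane) :
    enthalpyAt (U.potential ξ) U.v ξ = -U.k - ‖U.v‖ ^ 2 / 2 := by
  unfold enthalpyAt potential
  rw [norm_sub_sq_real]
  ring

/-- The density of a constant state; it does not depend on `ξ`, see `flowDensity_eq`. -/
def rho (U : ConstState) (γ : ℝ) : ℝ := density γ (-U.k - ‖U.v‖ ^ 2 / 2)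

theorem flowDensity_eq (U : ConstState) (γ : ℝ) (ξ : Plane) :
    flowDensity γ (U.potential ξ) U.v ξ = U.rho γ := by
  rw [flowDensity, rho, enthalpyAt_eq]

/-- The sound speed of a constant state. -/
def sound (U : ConstState) (γ : ℝ) : ℝ := soundSpeed γ (U.rho γ)

/-- The constant state has a positive density. -/
def HasDensity (U : ConstState) (γ : ℝ) : Prop :=
  -U.k - ‖U.v‖ ^ 2 / 2 ∈ enthalpy γ '' Set.Ioi 0

end ConstState

/-- `ψ` is `C¹` on `K`, with gradient `v`.  (Used for closures of open sets.) -/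
def IsC1On (K : Set Plane) (ψ : Plane → ℝ) (v : Plane → Plane) : Prop :=
  (∀ ξ ∈ K, HasGradientWithinAt ψ (v ξ) K ξ) ∧ ContinuousOn v K

/-- `ψ`, with gradient `v`, is a weak solution in the open set `E` of self-similar potential flow
`∇ · (ρ ∇χ) + 2 ρ = 0`.  The flux `ρ ∇χ` of a `C¹` potential is continuous, so that testing with
`C¹` functions of compact support is the same as testing with smooth ones. -/
def IsWeakSolution (γ : ℝ) (E : Set Plane) (ψ : Plane → ℝ) (v : Plane → Plane) : Prop :=
  ∀ φ : Plane → ℝ, ContDiff ℝ 1 φ → HasCompactSupport φ → tsupport φ ⊆ E →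
    ∫ ξ in E, (flowDensity γ (ψ ξ) (v ξ) ξ * inner ℝ (v ξ - ξ) (gradient φ ξ)
      - 2 * flowDensity γ (ψ ξ) (v ξ) ξ * φ ξ) = 0

/-- The slip condition `z · n = 0` at a point `ξ` of a wall with normal `n`. -/
def IsSlip (v ξ n : Plane) : Prop := inner ℝ (v - ξ) n = 0

/-- The conditions at a point `ξ` of a shock with unit normal `n` pointing downstream, between an
upstream flow (potential `uu`, velocity `vu`) and a downstream flow (potential `ud`, velocity `vd`):
continuity of the potential, the Rankine-Hugoniot condition, and admissibility with positive
strength. -/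
structure IsShockAt (γ uu : ℝ) (vu : Plane) (ud : ℝ) (vd ξ n : Plane) : Prop where
  norm_normal : ‖n‖ = 1
  potential_eq : uu = ud
  mass : flowDensity γ uu vu ξ * inner ℝ (vu - ξ) n = flowDensity γ ud vd ξ * inner ℝ (vd - ξ) n
  downstream : 0 < inner ℝ (vd - ξ) n
  admissible : inner ℝ (vd - ξ) n < inner ℝ (vu - ξ) n

/-- The shock function `g(v, ξ)` for the constant upstream state `U`. -/
def shockFun (γ : ℝ) (U : ConstState) (v ξ : Plane) : ℝ :=
  inner ℝ (flowDensity γ (U.potential ξ) v ξ • (v - ξ) - U.rho γ • (U.v - ξ))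
    (‖U.v - v‖⁻¹ • (U.v - v))

/-- A shock at `ξ` with upstream state `U` and downstream velocity `v` is strong-type if
`g_v(v, ξ) · z > 0`, where `z = v - ξ` is the downstream pseudo-velocity. -/
def IsStrongTypeAt (γ : ℝ) (U : ConstState) (v ξ : Plane) : Prop :=
  0 < inner ℝ (gradient (fun w => shockFun γ U w ξ) v) (v - ξ)

/-! ### The elliptic region behind a transonic reflected shock -/

/-- The properties common to both problems of a potential `ψ` (velocity `v = ∇ψ`) in an elliptic
region `E` that is adjacent to the curve `σ ((0, 1))` on the reflected shock, which starts in the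
reflection point `σ 0`, and to the part `AE` (an open segment, outer normal `nA`) of the reflection
wall.  The upstream state is `U`, and `D` is the union of all regions downstream of the reflected
shock; `n s` is the downstream unit normal of the shock at `σ s`. -/
structure IsTransonicPatch (γ : ℝ) (U : ConstState) (E D : Set Plane) (ψ : Plane → ℝ)
    (v : Plane → Plane) (σ n : ℝ → Plane) (AE : Set Plane) (nA : Plane) : Prop where
  upstream_density : U.HasDensity γ
  isOpen : IsOpen E
  isConnected : IsConnected E
  isBounded : Bornology.IsBounded E
  c1 : IsC1On (closure E) ψ v
  density_pos : ∀ ξ ∈ closure E, HasPositiveDensity γ (ψ ξ) (v ξ) ξ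
  weakSolution : IsWeakSolution γ E ψ v
  elliptic : ∀ ξ ∈ E, IsPseudoSubsonic γ (ψ ξ) (v ξ) ξ
  elliptic_wall : ∀ ξ ∈ AE, IsPseudoSubsonic γ (ψ ξ) (v ξ) ξ
  /-- The shock is transonic, also in the reflection point. -/
  transonic : ∀ s ∈ Set.Ico (0 : ℝ) 1, IsPseudoSubsonic γ (ψ (σ s)) (v (σ s)) (σ s)
  slip : ∀ ξ ∈ AE, IsSlip (v ξ) ξ nA
  /-- The shock is a simple regular curve that is `C¹` up to and including both endpoints. -/
  shock_c1 : ContDiffOn ℝ 1 σ (Set.Icc 0 1)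
  shock_regular : ∀ s ∈ Set.Icc (0 : ℝ) 1, derivWithin σ (Set.Icc 0 1) s ≠ 0
  shock_inj : Set.InjOn σ (Set.Icc 0 1)
  normal_cont : ContinuousOn n (Set.Icc 0 1)
  normal_perp : ∀ s ∈ Set.Icc (0 : ℝ) 1, inner ℝ (n s) (derivWithin σ (Set.Icc 0 1) s) = 0
  /-- The normal points into `E`; the region on the other side of the shock is upstream. -/
  normal_side : ∀ s ∈ Set.Ioo (0 : ℝ) 1, ∀ᶠ t in nhdsWithin (0 : ℝ) (Set.Ioi 0),
    σ s + t • n s ∈ E ∧ σ s - t • n s ∉ closure D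
  shock : ∀ s ∈ Set.Icc (0 : ℝ) 1,
    IsShockAt γ (U.potential (σ s)) U.v (ψ (σ s)) (v (σ s)) (σ s) (n s)

/-- A global regular reflection with transonic reflected shock in a convex corner between the
reflection wall `A = {corner + s a | s > 0}` and the opposite wall `B = {corner + s b | s > 0}`
(classical regular reflection), in the frame of any observer.

The straight incident shock, the ray from `refl` in direction `q`, separates the constant state
`U₁` adjacent to `A` from the constant state `U` between the incident shock, the reflected shock and
`B`.  The elliptic region `E` is enclosed by the reflected shock `σ`, which runs from the reflection
point `refl` on `A` to the point `foot` on `B`, and by the two walls. -/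
structure ClassicalReflection (γ : ℝ) where
  corner : Plane
  /-- The directions of the walls `A` and `B`, and their unit normals, outer to the flow domain. -/
  a : Plane
  b : Plane
  nA : Plane
  nB : Plane
  norm_a : ‖a‖ = 1
  norm_b : ‖b‖ = 1
  norm_nA : ‖nA‖ = 1
  norm_nB : ‖nB‖ = 1
  nA_perp : inner ℝ nA a = 0
  nB_perp : inner ℝ nB b = 0
  nA_outer : inner ℝ nA b < 0
  nB_outer : inner ℝ nB a < 0
  /-- The distances of the reflection point and of the foot of the reflected shock from the
  corner. -/
  lenA : ℝ
  lenB : ℝ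
  lenA_pos : 0 < lenA
  lenB_pos : 0 < lenB
  refl : Plane
  foot : Plane
  refl_eq : refl = corner + lenA • a
  foot_eq : foot = corner + lenB • b
  /-- The states in front of and behind the incident shock. -/
  U₁ : ConstState
  U : ConstState
  /-- The direction of the incident shock and its normal, pointing away from the region of
  `U₁`. -/
  q : Plane
  nQ : Plane
  q_ne_zero : q ≠ 0
  nQ_perp : inner ℝ nQ q = 0
  nQ_side : inner ℝ nQ a < 0
  /-- The elliptic region, the potential and its gradient on the closure of that region, and the
  reflected shock with its downstream normal. -/
  E : Set Plane
  ψ : Plane → ℝ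
  v : Plane → Plane
  σ : ℝ → Plane
  n : ℝ → Plane
  incident_density : U₁.HasDensity γ
  /-- The incident shock runs to infinity inside the flow domain, outside of the closure
  of `E`. -/
  incident_domain : ∀ s : ℝ, 0 < s →
    inner ℝ nA (refl + s • q - corner) < 0 ∧ inner ℝ nB (refl + s • q - corner) < 0
  incident_disjoint : ∀ s : ℝ, 0 < s → refl + s • q ∉ closure E
  incident_shock : ∀ s : ℝ, 0 ≤ s →
    IsShockAt γ (U₁.potential (refl + s • q)) U₁.v (U.potential (refl + s • q)) U.v
      (refl + s • q) nQ
  /-- The slip conditions for the two constant states. -/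
  slip_U₁ : ∀ s : ℝ, lenA ≤ s → IsSlip U₁.v (corner + s • a) nA
  slip_U : ∀ s : ℝ, lenB ≤ s → IsSlip U.v (corner + s • b) nB
  /-- `E` and the reflected shock lie in the flow domain. -/
  E_domain : ∀ ξ ∈ E, inner ℝ nA (ξ - corner) < 0 ∧ inner ℝ nB (ξ - corner) < 0
  shock_domain : ∀ s ∈ Set.Ioo (0 : ℝ) 1,
    inner ℝ nA (σ s - corner) < 0 ∧ inner ℝ nB (σ s - corner) < 0
  shock_start : σ 0 = refl
  shock_end : σ 1 = foot
  /-- `E` is the region enclosed by the reflected shock and the two walls. -/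
  frontier_E : frontier E = σ '' Set.Icc 0 1 ∪ segment ℝ corner refl ∪ segment ℝ corner foot
  patch : IsTransonicPatch γ U E E ψ v σ n (openSegment ℝ corner refl) nA
  slip_B : ∀ ξ ∈ openSegment ℝ corner foot, IsSlip (v ξ) ξ nB

namespace ClassicalReflection

/-- The angle between `n_B` and the velocity `v^I` upstream of the reflected shock, as seen by an
observer who moves with the velocity of the elliptic region at the reflection point. -/
def angleB {γ : ℝ} (R : ClassicalReflection γ) : ℝ :=
  InnerProductGeometry.angle (R.U.v - R.v R.refl) R.nB

/-- The reflected shock is strong-type (in the reflection point). -/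
def IsStrongType {γ : ℝ} (R : ClassicalReflection γ) : Prop :=
  IsStrongTypeAt γ R.U (R.v R.refl) R.refl

end ClassicalReflection

/-- A global transonic regular reflection for supersonic flow onto a wedge, in the frame of any
observer.  The wedge has its tip at the reflection point `refl`, and its surface is the ray
`{refl + s a | s > 0}`.  The reflected shock consists of the curve `σ` from `refl` to `top` and of the
ray from `top` in direction `a`, parallel to the wedge surface.  The elliptic region `E` is bounded
by the curve `σ`, by the wedge surface between `refl` and `bottom`, and by the arc `P` of the sonic
circle of the constant state `H` that fills the rest of the region between the shock and the
wedge. -/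
structure WedgeReflection (γ : ℝ) where
  /-- The upstream state. -/
  U : ConstState
  /-- The state behind the straight part of the reflected shock. -/
  H : ConstState
  refl : Plane
  /-- The direction of the wedge surface and its unit normal, pointing into the wedge. -/
  a : Plane
  nA : Plane
  norm_a : ‖a‖ = 1
  norm_nA : ‖nA‖ = 1
  nA_perp : inner ℝ nA a = 0
  /-- The upstream flow, as seen from the wedge tip, is supersonic and directed onto the wedge, at an
  angle between `0` and `90` degrees to its surface. -/
  supersonic : U.sound γ < ‖U.v - refl‖
  onto_wedge : 0 < inner ℝ nA (U.v - refl)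
  along_wedge : 0 < inner ℝ a (U.v - refl)
  /-- The endpoints of `P` on the shock and on the wedge. -/
  top : Plane
  bottom : Plane
  len : ℝ
  len_pos : 0 < len
  bottom_eq : bottom = refl + len • a
  /-- The elliptic region, the potential and its gradient downstream of the reflected shock, and the
  curved part of the reflected shock with its downstream normal. -/
  E : Set Plane
  ψ : Plane → ℝ
  v : Plane → Plane
  σ : ℝ → Plane
  n : ℝ → Plane
  H_density : H.HasDensity γ
  /-- `P` is an arc of the circle on which the pseudo-Mach number of `H` is `1`. -/
  top_sonic : ‖top - H.v‖ = H.sound γ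
  bottom_sonic : ‖bottom - H.v‖ = H.sound γ
  top_right : 0 < inner ℝ a (top - H.v)
  bottom_right : 0 < inner ℝ a (bottom - H.v)
  top_domain : inner ℝ nA (top - refl) < 0
  /-- The slip condition for the constant state `H`. -/
  slip_H : ∀ s : ℝ, len ≤ s → IsSlip H.v (refl + s • a) nA
  /-- The shock conditions on the straight part of the reflected shock. -/
  shock_H : ∀ s : ℝ, 0 ≤ s →
    IsShockAt γ (U.potential (top + s • a)) U.v (H.potential (top + s • a)) H.v (top + s • a) nA
  /-- `E` and the reflected shock lie on the flow side of the wedge surface. -/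
  E_domain : ∀ ξ ∈ E, inner ℝ nA (ξ - refl) < 0
  shock_domain : ∀ s ∈ Set.Ioo (0 : ℝ) 1, inner ℝ nA (σ s - refl) < 0
  shock_start : σ 0 = refl
  shock_end : σ 1 = top
  /-- The curved and the straight part of the reflected shock together form a `C¹` curve. -/
  shock_tangent : ∃ r : ℝ, 0 < r ∧ derivWithin σ (Set.Icc 0 1) 1 = r • a

namespace WedgeReflection

/-- The hyperbolic region of the constant state `H`: between the straight part of the shock and the
wedge, outside of the sonic circle, and extending to infinity in the direction `a`. -/
def regionH {γ : ℝ} (R : WedgeReflection γ) : Set Plane :=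
  {ξ | inner ℝ R.nA (ξ - R.refl) < 0 ∧ 0 < inner ℝ R.nA (ξ - R.top) ∧
    R.H.sound γ < ‖ξ - R.H.v‖ ∧ 0 < inner ℝ R.a (ξ - R.H.v)}

/-- The sonic arc `P` (without endpoints). -/
def arcP {γ : ℝ} (R : WedgeReflection γ) : Set Plane :=
  {ξ | inner ℝ R.nA (ξ - R.refl) < 0 ∧ 0 < inner ℝ R.nA (ξ - R.top) ∧
    ‖ξ - R.H.v‖ = R.H.sound γ ∧ 0 < inner ℝ R.a (ξ - R.H.v)}

/-- The data form a global transonic regular reflection. -/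
structure IsFlow {γ : ℝ} (R : WedgeReflection γ) : Prop where
  disjoint : Disjoint R.E R.regionH
  /-- `E` is the region enclosed by the curved part of the shock, the wedge and `P`. -/
  frontier_E : frontier R.E = R.σ '' Set.Icc 0 1 ∪ segment ℝ R.refl R.bottom ∪ R.arcP
  /-- `ψ` is `C¹` on the closure of the union of both downstream regions. -/
  c1 : IsC1On (closure (R.E ∪ R.regionH)) R.ψ R.v
  psi_H : ∀ ξ ∈ R.regionH, R.ψ ξ = R.H.potential ξ ∧ R.v ξ = R.H.v
  patch : IsTransonicPatch γ R.U R.E (R.E ∪ R.regionH) R.ψ R.v R.σ R.n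
    (openSegment ℝ R.refl R.bottom) R.nA

/-- The reflected shock is strong-type (in the reflection point). -/
def IsStrongType {γ : ℝ} (R : WedgeReflection γ) : Prop :=
  IsStrongTypeAt γ R.U (R.v R.refl) R.refl

end WedgeReflection

end

/-! Suppose the shock is strong-type at the reflection point `ξ_r`, and compare `ψ` with the affine
function `ℓ` that equals `ψ` at `ξ_r` and has velocity `w = v(ξ_r) + η ε e`. Here `η = ±1`, `ε > 0`
is small, and `e` is the pseudo-velocity `z(ξ_r)` tilted slightly off the wall. The shock conditions
give `g(v(ξ_r), ξ_r) = 0` and strong-type means `g_v · z > 0`, so `g(w, ξ_r)` has the sign of `η`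
(`exists_perturbation`). The contradiction is that the continuous function `η (ψ - ℓ)` has no
possible minimum point on the compact closure of `E`.

Interior: ellipticity gives a maximum principle for `ψ` minus an affine function
(`weak_maximum_principle`). As `ψ` is only a `C¹` weak solution, it is proved by testing with the
squared truncation of a quadratically perturbed difference near a hypothetical minimum. The mass
flux is monotone in the velocity there, and the quadratic perturbation makes the comparison strict.

Shock: at a minimum in the interior of the shock, the velocity differs from `w` only by a normal
component, so the shock has the normal that a shock with downstream velocity `w` would have at
`ξ_r`. The minimum value is at most the value `0` at `ξ_r`, which says on which side the shock lies.
The inner normal derivative says how the downstream normal velocity has changed. Both changes act on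
the mass balance in the direction of `η`, as does `g(w, ξ_r)`, so the Rankine-Hugoniot condition
fails (`massBalance_contradiction`, `not_min_on_shock`). The facts about the gas used here are that
the balance is monotone when a shock of fixed strength is shifted along its normal, and that the
normal mass flux is log-concave in the normal velocity.

Walls and corners: first order conditions suffice. The slip condition fixes the normal velocity
along a straight wall, so the tilt of `e` excludes the reflection wall, and the component of `e`
along the wall excludes `ξ_r` itself. In classical reflection the normal component of `w` on `B`
must have the right sign; `η` is chosen accordingly, which is possible because the angle is not
`90°`. For `η = -1` one also needs that the shock at `ξ_r` turns the flow as it should, and this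
follows from the position of the incident shock outside `E` (`normal_side_A`, `normal_side_b`).

In the wedge problem `η = 1` works. On the sonic arc `ψ` coincides with the affine potential of `H`,
so `ψ - ℓ` is affine there with an outward gradient component, which excludes a minimum
(`not_min_on_arc`). -/

open Set Filter Topology MeasureTheory

/-! ### The density as a function of the enthalpy -/

/-- The range `π((0, ∞))`. -/
def enthalpyRange (γ : ℝ) : Set ℝ := enthalpy γ '' Ioi 0

/-- The derivative `dρ/dπ = ρ / c²`. -/
noncomputable def densityDeriv (γ s : ℝ) : ℝ := density γ s / (γ * density γ s ^ (γ - 1))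

theorem mem_enthalpyRange {γ s : ℝ} (hγ : 1 ≤ γ) : s ∈ enthalpyRange γ ↔ γ = 1 ∨ 0 < s := by
  unfold enthalpyRange
  by_cases h : γ = 1
  · subst h
    simp only [true_or, iff_true]
    exact ⟨Real.exp s, Real.exp_pos s, by simp [enthalpy]⟩
  · have h1 : 0 < γ - 1 := sub_pos.mpr (lt_of_le_of_ne hγ (Ne.symm h))
    have h0 : 0 < γ := by linarith
    simp only [h, false_or]
    constructor
    · rintro ⟨ρ, hρ, rfl⟩
      have hρ : 0 < ρ := hρ
      simp only [enthalpy, h, if_false]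
      positivity
    · intro hs
      have hq : 0 < (γ - 1) / γ * s := by positivity
      refine ⟨((γ - 1) / γ * s) ^ (1 / (γ - 1)), Real.rpow_pos_of_pos hq _, ?_⟩
      simp only [enthalpy, h, if_false]
      rw [← Real.rpow_mul hq.le, one_div_mul_cancel h1.ne', Real.rpow_one]
      field_simp

theorem enthalpyRange_of_le {γ s t : ℝ} (hγ : 1 ≤ γ) (hs : s ∈ enthalpyRange γ) (h : s ≤ t) :
    t ∈ enthalpyRange γ := by
  rw [mem_enthalpyRange hγ] at *
  exact hs.imp_right fun h' => h'.trans_le h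

theorem isOpen_enthalpyRange {γ : ℝ} (hγ : 1 ≤ γ) : IsOpen (enthalpyRange γ) := by
  by_cases h : γ = 1
  · have : enthalpyRange γ = univ := eq_univ_of_forall fun s => (mem_enthalpyRange hγ).2 (Or.inl h)
    rw [this]; exact isOpen_univ
  · have : enthalpyRange γ = Ioi 0 := by
      ext s; simp [mem_enthalpyRange hγ, h]
    rw [this]; exact isOpen_Ioi

theorem density_pos {γ s : ℝ} (hγ : 1 ≤ γ) (hs : s ∈ enthalpyRange γ) : 0 < density γ s := by
  obtain ⟨ρ, hρ, rfl⟩ := hs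
  rw [density_enthalpy hγ hρ]
  exact hρ

theorem densityDeriv_pos {γ s : ℝ} (hγ : 1 ≤ γ) (hs : s ∈ enthalpyRange γ) :
    0 < densityDeriv γ s := by
  have := density_pos hγ hs
  have : 0 < γ := by linarith
  unfold densityDeriv
  positivity

theorem hasStrictDerivAt_density {γ s : ℝ} (hγ : 1 ≤ γ) (hs : s ∈ enthalpyRange γ) :
    HasStrictDerivAt (density γ) (densityDeriv γ s) s := by
  have hsm := (mem_enthalpyRange hγ).1 hs
  by_cases h : γ = 1
  · subst h
    have : density 1 = Real.exp := by funext x; simp [density]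
    simp only [densityDeriv, this]
    simpa using Real.hasStrictDerivAt_exp s
  · have h1 : 0 < γ - 1 := sub_pos.mpr (lt_of_le_of_ne hγ (Ne.symm h))
    have h0 : 0 < γ := by linarith
    have hs0 : 0 < s := hsm.resolve_left h
    have he : density γ = fun s => ((γ - 1) / γ * s) ^ (1 / (γ - 1)) := by
      funext x; simp [density, h]
    have hq : 0 < (γ - 1) / γ * s := by positivity
    have hd : HasStrictDerivAt (fun s => ((γ - 1) / γ * s) ^ (1 / (γ - 1)))
        ((1 / (γ - 1)) * ((γ - 1) / γ * s) ^ (1 / (γ - 1) - 1) * ((γ - 1) / γ * 1)) s :=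
      (Real.hasStrictDerivAt_rpow_const_of_ne hq.ne' _).comp s
        ((hasStrictDerivAt_id s).const_mul ((γ - 1) / γ))
    simp only [densityDeriv, he]
    convert hd using 1
    rw [← Real.rpow_mul hq.le, one_div_mul_cancel h1.ne', Real.rpow_one, Real.rpow_sub_one hq.ne']
    field_simp

theorem continuousAt_density {γ s : ℝ} (hγ : 1 ≤ γ) (hs : s ∈ enthalpyRange γ) :
    ContinuousAt (density γ) s :=
  (hasStrictDerivAt_density hγ hs).hasDerivAt.continuousAt

theorem continuousAt_densityDeriv {γ s : ℝ} (hγ : 1 ≤ γ) (hs : s ∈ enthalpyRange γ) :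
    ContinuousAt (densityDeriv γ) s := by
  have hp := density_pos hγ hs
  have h0 : 0 < γ := by linarith
  have hc := continuousAt_density hγ hs
  unfold densityDeriv
  refine hc.div (continuousAt_const.mul (hc.rpow_const (Or.inl hp.ne'))) ?_
  positivity

theorem monotoneOn_density {γ : ℝ} (hγ : 1 ≤ γ) : MonotoneOn (density γ) (enthalpyRange γ) := by
  intro s hs t ht hst
  rw [mem_enthalpyRange hγ] at hs ht
  by_cases h : γ = 1
  · simp [density, h, hst]
  · have h1 : 0 < γ - 1 := sub_pos.mpr (lt_of_le_of_ne hγ (Ne.symm h))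
    have h0 : 0 < γ := by linarith
    have hs0 : 0 < s := hs.resolve_left h
    simp only [density, h, if_false]
    have hq : 0 < (γ - 1) / γ := by positivity
    exact Real.rpow_le_rpow (by positivity) (by gcongr) (by positivity)

/-- The logarithm of the density is the enthalpy itself if `γ = 1`, and otherwise a positive
multiple of its logarithm plus a constant. The density need not be concave: it is strictly convex
for `1 ≤ γ < 2`. -/
theorem concaveOn_log_density {γ : ℝ} (hγ : 1 ≤ γ) :
    ConcaveOn ℝ (enthalpyRange γ) fun s => Real.log (density γ s) := by
  by_cases h : γ = 1
  · subst h
    have : enthalpyRange 1 = univ := by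
      ext s; simp [mem_enthalpyRange hγ]
    rw [this]
    simp only [density, if_true, Real.log_exp]
    exact concaveOn_id convex_univ
  · have h1 : 0 < γ - 1 := sub_pos.mpr (lt_of_le_of_ne hγ (Ne.symm h))
    have h0 : 0 < γ := by linarith
    have : enthalpyRange γ = Ioi 0 := by
      ext s; simp [mem_enthalpyRange hγ, h]
    rw [this]
    have hc : ConcaveOn ℝ (Ioi (0 : ℝ))
        fun s => (1 / (γ - 1)) * (Real.log ((γ - 1) / γ) + Real.log s) := by
      refine ConcaveOn.smul (c := 1 / (γ - 1)) (by positivity) ?_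
      exact (concaveOn_const _ (convex_Ioi 0)).add strictConcaveOn_log_Ioi.concaveOn
    refine hc.congr fun s hs => ?_
    have hs : 0 < s := hs
    have hq : 0 < (γ - 1) / γ := by positivity
    simp only [density, h, if_false]
    rw [Real.log_rpow (by positivity), Real.log_mul hq.ne' hs.ne']

/-- As `dρ/dπ = ρ / c²`, this is `|z|² < c²` multiplied by `ρ / c²`; it is the form in which
ellipticity enters the estimates. -/
theorem pseudoSubsonic_iff {γ u : ℝ} {v ξ : Plane} (hγ : 1 ≤ γ) (hd : HasPositiveDensity γ u v ξ) :
    IsPseudoSubsonic γ u v ξ ↔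
      densityDeriv γ (enthalpyAt u v ξ) * ‖v - ξ‖ ^ 2 < density γ (enthalpyAt u v ξ) := by
  have h0 : 0 < γ := by linarith
  have hp := density_pos hγ hd
  have hr := Real.rpow_pos_of_pos hp (γ - 1)
  unfold IsPseudoSubsonic soundSpeed flowDensity densityDeriv
  have hder : deriv (pressure γ) (density γ (enthalpyAt u v ξ))
      = γ * density γ (enthalpyAt u v ξ) ^ (γ - 1) :=
    (Real.hasDerivAt_rpow_const (Or.inl hp.ne')).deriv
  rw [hder, Real.lt_sqrt (norm_nonneg _), div_mul_eq_mul_div, div_lt_iff₀ (by positivity),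
    mul_lt_mul_iff_right₀ hp]

/-! ### The jump relations along a shock normal -/

/-- The normal mass flux is log-concave in the normal velocity. -/
theorem concaveOn_log_massFlux {γ A y : ℝ} (hγ : 1 ≤ γ) (hA : A ∈ enthalpyRange γ) :
    ConcaveOn ℝ (Ioc 0 y)
      fun x => Real.log (density γ (A + (y ^ 2 - x ^ 2) / 2)) + Real.log x := by
  have hmem : ∀ x ∈ Ioc 0 y, A + (y ^ 2 - x ^ 2) / 2 ∈ enthalpyRange γ := by
    rintro x ⟨hx0, hxy⟩
    exact enthalpyRange_of_le hγ hA (by nlinarith)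
  refine ConcaveOn.add ⟨convex_Ioc 0 y, ?_⟩
    (strictConcaveOn_log_Ioi.concaveOn.subset (fun x hx => hx.1) (convex_Ioc 0 y))
  intro x hx x' hx' a b ha hb hab
  have h1 := (concaveOn_log_density hγ).2 (hmem x hx) (hmem x' hx') ha hb hab
  refine h1.trans ?_
  have hm := (concaveOn_log_density hγ).1 (hmem x hx) (hmem x' hx') ha hb hab
  -- The enthalpy is concave in `x`, and an increasing concave function of a concave function is
  -- concave.
  have hle : a • (A + (y ^ 2 - x ^ 2) / 2) + b • (A + (y ^ 2 - x' ^ 2) / 2)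
      ≤ A + (y ^ 2 - (a • x + b • x') ^ 2) / 2 := by
    have hb' : b = 1 - a := by linarith
    subst hb'
    simp only [smul_eq_mul]
    nlinarith [mul_nonneg (mul_nonneg ha hb) (sq_nonneg (x - x'))]
  exact Real.log_le_log (density_pos hγ hm)
    (monotoneOn_density hγ hm (enthalpyRange_of_le hγ hm hle) hle)

/-- The logarithm of the flux is concave on `(0, y]` and takes equal values at `x` and `y`, so it
cannot decrease to the left of `x`. -/
theorem massFlux_le_of_le {γ A x' x y : ℝ} (hγ : 1 ≤ γ) (hA : A ∈ enthalpyRange γ)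
    (hx' : 0 < x') (hx : x' ≤ x) (hxy : x < y)
    (h : density γ A * y = density γ (A + (y ^ 2 - x ^ 2) / 2) * x) :
    density γ (A + (y ^ 2 - x' ^ 2) / 2) * x' ≤ density γ A * y := by
  have hmem : ∀ t ∈ Ioc 0 y, 0 < density γ (A + (y ^ 2 - t ^ 2) / 2) := by
    rintro t ⟨ht0, hty⟩
    exact density_pos hγ (enthalpyRange_of_le hγ hA (by nlinarith))
  have hc := concaveOn_log_massFlux (y := y) hγ hA
  have h1 : x' ∈ Ioc 0 y := ⟨hx', by linarith⟩
  have h2 : x ∈ Ioc 0 y := ⟨by linarith, by linarith⟩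
  have h3 : y ∈ Ioc 0 y := ⟨by linarith, le_rfl⟩
  by_contra hlt
  push Not at hlt
  have hxx : x' < x := by
    refine lt_of_le_of_ne hx ?_
    rintro rfl
    exact absurd hlt (by rw [h]; exact lt_irrefl _)
  rw [h] at hlt
  have hl := Real.log_lt_log (mul_pos (hmem x h2) h2.1) hlt
  have he : Real.log (density γ (A + (y ^ 2 - x ^ 2) / 2) * x)
      = Real.log (density γ (A + (y ^ 2 - y ^ 2) / 2) * y) := by
    rw [← h]; simp
  rw [Real.log_mul (hmem x h2).ne' h2.1.ne'] at hl he
  rw [Real.log_mul (hmem x' h1).ne' h1.1.ne'] at hl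
  rw [Real.log_mul (hmem y h3).ne' h3.1.ne'] at he
  have hs := hc.slope_anti_adjacent h1 h3 hxx hxy
  beta_reduce at hs
  rw [← he, sub_self, zero_div] at hs
  have : (Real.log (density γ (A + (y ^ 2 - x ^ 2) / 2)) + Real.log x -
    (Real.log (density γ (A + (y ^ 2 - x' ^ 2) / 2)) + Real.log x')) / (x - x') < 0 :=
    div_neg_of_neg_of_pos (by linarith) (by linarith)
  linarith

/-- Between two points of equal value a concave function is at least that value. -/
theorem le_massFlux_of_le {γ A x' x y : ℝ} (hγ : 1 ≤ γ) (hA : A ∈ enthalpyRange γ)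
    (hx0 : 0 < x) (hx : x ≤ x') (hxy : x' ≤ y)
    (h : density γ A * y = density γ (A + (y ^ 2 - x ^ 2) / 2) * x) :
    density γ A * y ≤ density γ (A + (y ^ 2 - x' ^ 2) / 2) * x' := by
  have hmem : ∀ t ∈ Ioc 0 y, 0 < density γ (A + (y ^ 2 - t ^ 2) / 2) := by
    rintro t ⟨ht0, hty⟩
    exact density_pos hγ (enthalpyRange_of_le hγ hA (by nlinarith))
  have hc := concaveOn_log_massFlux (y := y) hγ hA
  have h1 : x' ∈ Ioc 0 y := ⟨by linarith, by linarith⟩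
  have h2 : x ∈ Ioc 0 y := ⟨by linarith, by linarith⟩
  have h3 : y ∈ Ioc 0 y := ⟨by linarith, le_rfl⟩
  have he : Real.log (density γ (A + (y ^ 2 - x ^ 2) / 2) * x)
      = Real.log (density γ (A + (y ^ 2 - y ^ 2) / 2) * y) := by
    rw [← h]; simp
  have hm := hc.min_le_of_mem_Icc h2 h3 ⟨hx, hxy⟩
  rw [← Real.log_mul (hmem x h2).ne' h2.1.ne', ← Real.log_mul (hmem y h3).ne' h3.1.ne',
    ← Real.log_mul (hmem x' h1).ne' h1.1.ne', ← he, min_self, ← h] at hm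
  have hA' := density_pos hγ hA
  exact (Real.log_le_log_iff (mul_pos hA' h3.1) (mul_pos (hmem x' h1) h1.1)).1 hm

/-- Moving a shock of fixed strength `l` along its normal changes the mass balance
monotonically. -/
theorem massBalance_mono {γ A l x x' : ℝ} (hγ : 1 ≤ γ) (hA : A ∈ enthalpyRange γ)
    (hl : 0 ≤ l) (hx : 0 < x) (hxx : x ≤ x') :
    density γ (A + ((x + l) ^ 2 - x ^ 2) / 2) * x - density γ A * (x + l)
      ≤ density γ (A + ((x' + l) ^ 2 - x' ^ 2) / 2) * x' - density γ A * (x' + l) := by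
  -- For fixed `l` the downstream enthalpy is affine and nondecreasing in `t`. The balance is `(ρ_d
  -- - ρ_u) t - ρ_u l`, where `ρ_d - ρ_u` is nonnegative and nondecreasing.
  have e : ∀ t : ℝ, A + ((t + l) ^ 2 - t ^ 2) / 2 = A + l * (t + l / 2) := fun t => by ring
  rw [e, e]
  have h1 : A ≤ A + l * (x + l / 2) := by nlinarith
  have h2 : A + l * (x + l / 2) ≤ A + l * (x' + l / 2) := by nlinarith
  have m1 := enthalpyRange_of_le hγ hA h1
  have d1 := monotoneOn_density hγ hA m1 h1
  have d2 := monotoneOn_density hγ m1 (enthalpyRange_of_le hγ m1 h2) h2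
  nlinarith [mul_nonneg (sub_nonneg.2 d2) hx.le,
    mul_nonneg (sub_nonneg.2 (d1.trans d2)) (sub_nonneg.2 hxx)]

/-- A shock whose normal direction and upstream state are kept, and which is moved by `H` against
its normal, cannot have its downstream velocity increased by `m` if `H`, `m` and the mass balance
of the original discontinuity have the same sign. -/
theorem massBalance_contradiction {γ A η x y H m : ℝ} (hγ : 1 ≤ γ) (hA : A ∈ enthalpyRange γ)
    (hη : η = 1 ∨ η = -1) (hH : 0 ≤ η * H) (hm : 0 ≤ η * m) (hxy : x < y)
    (hx0 : η = 1 → 0 < x) (hx1 : 0 < x + H + m) (hxy1 : x + H + m < y + H)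
    (hg : 0 < η * (density γ (A + (y ^ 2 - x ^ 2) / 2) * x - density γ A * y))
    (h : density γ A * (y + H)
      = density γ (A + ((y + H) ^ 2 - (x + H + m) ^ 2) / 2) * (x + H + m)) : False := by
  have e1 : y = x + (y - x) := by ring
  have e2 : y + H = x + H + (y - x) := by ring
  -- The passage to the actual shock is split in two through `x + H`: first the shift by `H` at
  -- fixed strength `y - x`, then the change `m` of the downstream velocity. Mass conservation at `x
  -- + H + m` bounds the balance at `x + H` by log-concavity, and monotonicity carries the bound
  -- back to `x`, against `hg`.
  rcases hη with rfl | rfl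
  · have h1 := massFlux_le_of_le (x' := x + H) hγ hA (by linarith [hx0 rfl]) (by linarith) hxy1 h
    have h2 := massBalance_mono (l := y - x) (x' := x + H) hγ hA (by linarith) (hx0 rfl)
      (by linarith)
    rw [← e1, ← e2] at h2
    linarith
  · have h1 := le_massFlux_of_le (x' := x + H) hγ hA hx1 (by linarith) (by linarith) h
    have h2 := massBalance_mono (x := x + H) (l := y - x) (x' := x) hγ hA (by linarith)
      (by linarith) (by linarith)
    rw [← e1, ← e2] at h2
    linarith

/-! ### Integration by parts -/

theorem continuous_of_continuousOn_of_eq_zero {X Y : Type*} [TopologicalSpace X]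
    [TopologicalSpace Y] [Zero Y] {O K : Set X} (hO : IsOpen O) (hK : IsClosed K) (hKO : K ⊆ O)
    {f : X → Y} (hf : ContinuousOn f O) (h0 : ∀ x ∉ K, f x = 0) : Continuous f := by
  rw [continuous_iff_continuousAt]
  intro x
  by_cases hx : x ∈ K
  · exact hf.continuousAt (hO.mem_nhds (hKO hx))
  · have : f =ᶠ[𝓝 x] fun _ => 0 := by
      filter_upwards [hK.isOpen_compl.mem_nhds hx] with y hy using h0 y hy
    exact (continuousAt_const.congr this.symm)

theorem integrable_of_continuousOn_of_eq_zero {O K : Set Plane} (hO : IsOpen O) (hK : IsCompact K)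
    (hKO : K ⊆ O) {f : Plane → ℝ} (hf : ContinuousOn f O) (h0 : ∀ x ∉ K, f x = 0) :
    Integrable f :=
  (continuous_of_continuousOn_of_eq_zero hO hK.isClosed hKO hf h0).integrable_of_hasCompactSupport
    (HasCompactSupport.intro hK h0)

theorem plane_inner (x y : Plane) : inner ℝ x y = x 0 * y 0 + x 1 * y 1 := by
  simp [PiLp.inner_apply, Fin.sum_univ_two, mul_comm]

theorem plane_inner_single (x : Plane) (i : Fin 2) :
    inner ℝ x (EuclideanSpace.single i 1) = x i := by
  rw [plane_inner]
  fin_cases i <;> simp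

theorem gradient_apply {φ : Plane → ℝ} {ξ : Plane} (h : DifferentiableAt ℝ φ ξ) (i : Fin 2) :
    gradient φ ξ i = fderiv ℝ φ ξ (EuclideanSpace.single i 1) := by
  have := h.hasGradientAt.hasFDerivAt.fderiv
  rw [this, InnerProductSpace.toDual_apply_apply, plane_inner_single]

/-- Divergence theorem for the field `r(ξ) (ξ - c)`, tested with a function `φ`. -/
theorem integral_radial_divergence {O : Set Plane} (hO : IsOpen O) {r : Plane → ℝ}
    {g : Plane → Plane} (hr : ∀ ξ ∈ O, HasGradientAt r (g ξ) ξ) (hg : ContinuousOn g O)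
    {φ : Plane → ℝ} (hφ : ContDiff ℝ 1 φ) (hc : HasCompactSupport φ) (hs : tsupport φ ⊆ O)
    (c : Plane) :
    ∫ ξ, (r ξ * inner ℝ (ξ - c) (gradient φ ξ) + (2 * r ξ + inner ℝ (g ξ) (ξ - c)) * φ ξ) = 0 := by
  have hdφ : Differentiable ℝ φ := hφ.differentiable one_ne_zero
  have hcφ : Continuous (fderiv ℝ φ) := hφ.continuous_fderiv one_ne_zero
  have hrc : ContinuousOn r O := fun ξ hξ => (hr ξ hξ).hasFDerivAt.continuousAt.continuousWithinAt
  have hz : ∀ ξ ∉ tsupport φ, φ ξ = 0 := fun ξ hξ => image_eq_zero_of_notMem_tsupport hξ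
  have hz' : ∀ ξ ∉ tsupport φ, fderiv ℝ φ ξ = 0 := fun ξ hξ => by
    by_contra hne
    exact hξ (support_fderiv_subset ℝ hne)
  have hf : ∀ (i : Fin 2), ∀ ξ ∈ O, HasFDerivAt (fun ξ : Plane => r ξ * (ξ i - c i))
      (r ξ • (EuclideanSpace.proj i : Plane →L[ℝ] ℝ)
        + (ξ i - c i) • InnerProductSpace.toDual ℝ Plane (g ξ)) ξ := by
    intro i ξ hξ
    have h1 : HasFDerivAt (fun ξ : Plane => ξ i - c i)
        (EuclideanSpace.proj i : Plane →L[ℝ] ℝ) ξ :=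
      ((EuclideanSpace.proj i : Plane →L[ℝ] ℝ).hasFDerivAt).sub_const (c i)
    exact (hr ξ hξ).hasFDerivAt.mul h1
  have hf' : ∀ (i : Fin 2), ∀ ξ ∈ O, fderiv ℝ (fun ξ : Plane => r ξ * (ξ i - c i)) ξ
      (EuclideanSpace.single i 1) = r ξ + (ξ i - c i) * g ξ i := by
    intro i ξ hξ
    rw [(hf i ξ hξ).fderiv]
    simp [plane_inner_single]
  have hcoord : ∀ i : Fin 2, Continuous fun ξ : Plane => ξ i - c i := fun i => by fun_prop
  have hgi : ∀ i : Fin 2, ContinuousOn (fun ξ => g ξ i) O := fun i =>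
    (EuclideanSpace.proj i : Plane →L[ℝ] ℝ).continuous.comp_continuousOn hg
  have I1 : ∀ i : Fin 2, Integrable fun ξ : Plane =>
      fderiv ℝ (fun ξ : Plane => r ξ * (ξ i - c i)) ξ (EuclideanSpace.single i 1) * φ ξ := by
    intro i
    refine integrable_of_continuousOn_of_eq_zero hO hc hs ?_ fun ξ hξ => by rw [hz ξ hξ, mul_zero]
    refine ContinuousOn.mul ?_ hφ.continuous.continuousOn
    refine ContinuousOn.congr ?_ (hf' i)
    exact hrc.add ((hcoord i).continuousOn.mul (hgi i))
  have I2 : ∀ i : Fin 2, Integrable fun ξ : Plane =>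
      r ξ * (ξ i - c i) * fderiv ℝ φ ξ (EuclideanSpace.single i 1) := by
    intro i
    refine integrable_of_continuousOn_of_eq_zero hO hc hs ?_ fun ξ hξ => by simp [hz' ξ hξ]
    exact (hrc.mul (hcoord i).continuousOn).mul (hcφ.clm_apply continuous_const).continuousOn
  have I3 : ∀ i : Fin 2, Integrable fun ξ : Plane => r ξ * (ξ i - c i) * φ ξ := by
    intro i
    refine integrable_of_continuousOn_of_eq_zero hO hc hs ?_ fun ξ hξ => by rw [hz ξ hξ, mul_zero]
    exact (hrc.mul (hcoord i).continuousOn).mul hφ.continuous.continuousOn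
  have key : ∀ i : Fin 2, ∫ ξ : Plane,
      (r ξ * (ξ i - c i) * fderiv ℝ φ ξ (EuclideanSpace.single i 1)
        + fderiv ℝ (fun ξ : Plane => r ξ * (ξ i - c i)) ξ (EuclideanSpace.single i 1) * φ ξ)
      = 0 := by
    intro i
    rw [integral_add (I2 i) (I1 i), integral_mul_fderiv_eq_neg_fderiv_mul_of_integrable (I1 i)
      (I2 i) (I3 i) (fun ξ hξ => (hf i ξ (hs hξ)).differentiableAt) (fun ξ _ => hdφ ξ)]
    simp
  have hsum := congrArg₂ (· + ·) (key 0) (key 1)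
  simp only [add_zero] at hsum
  rw [← hsum]
  refine Eq.trans ?_ (integral_add ((I2 0).add (I1 0)) ((I2 1).add (I1 1)))
  refine integral_congr_ae (Eventually.of_forall fun ξ => ?_)
  simp only
  rw [← gradient_apply (hdφ ξ), ← gradient_apply (hdφ ξ)]
  by_cases hξ : ξ ∈ tsupport φ
  · rw [hf' 0 ξ (hs hξ), hf' 1 ξ (hs hξ), plane_inner, plane_inner]
    simp only [PiLp.sub_apply]
    ring
  · have hg0 : gradient φ ξ = 0 := by rw [gradient, hz' ξ hξ, map_zero]
    rw [hz ξ hξ, hg0]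
    simp

/-! ### The comparison argument for weak solutions -/

/-- Squaring removes the kink of the positive part, so that truncations of a `C¹` function become
admissible `C¹` test functions. -/
theorem hasDerivAt_sq_max (s : ℝ) :
    HasDerivAt (fun s : ℝ => max s 0 ^ 2) (2 * max s 0) s := by
  rcases lt_trichotomy s 0 with h | rfl | h
  · have : (fun s : ℝ => max s 0 ^ 2) =ᶠ[𝓝 s] fun _ => 0 := by
      filter_upwards [Iio_mem_nhds h] with t ht
      rw [max_eq_right (le_of_lt ht)]; norm_num
    rw [max_eq_right h.le, mul_zero]
    exact (hasDerivAt_const s (0 : ℝ)).congr_of_eventuallyEq this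
  · rw [max_self, mul_zero, hasDerivAt_iff_isLittleO_nhds_zero]
    have h1 : (fun h : ℝ => max (0 + h) 0 ^ 2 - max 0 0 ^ 2 - h • (0 : ℝ))
        =O[𝓝 0] fun h : ℝ => h ^ 2 := by
      refine Asymptotics.IsBigO.of_bound 1 (Eventually.of_forall fun h => ?_)
      rcases le_total h 0 with h0 | h0
      · simp [h0, sq_nonneg]
      · simp [h0]
    refine h1.trans_isLittleO ?_
    simpa using (Asymptotics.isLittleO_pow_id (n := 2) (by norm_num) :
      (fun h : ℝ => h ^ 2) =o[𝓝 0] fun h => h)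
  · have : (fun s : ℝ => max s 0 ^ 2) =ᶠ[𝓝 s] fun s => s ^ 2 := by
      filter_upwards [Ioi_mem_nhds h] with t ht
      rw [max_eq_left (le_of_lt ht)]
    rw [max_eq_left h.le]
    have h2 := hasDerivAt_pow 2 s
    norm_num at h2
    exact h2.congr_of_eventuallyEq this

/-- A function `u` cannot have an interior minimum if near its minimum set the field `r(ξ) (ξ - c)`
is a strict sub- or supersolution that agrees with the flux `J` up to a monotone function
of `∇u`. -/
theorem false_of_strict_comparison {E O : Set Plane} {J q g : Plane → Plane} {G u r : Plane → ℝ}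
    {c : Plane} {τ η : ℝ} (hO : IsOpen O) (hOE : O ⊆ E)
    (hK : IsCompact {ξ ∈ closure E | u ξ ≤ τ}) (hKO : {ξ ∈ closure E | u ξ ≤ τ} ⊆ O)
    (hu : ∀ ξ ∈ O, HasGradientAt u (q ξ) ξ) (hq : ContinuousOn q O)
    (hJ : ContinuousOn J O) (hG : ContinuousOn G O)
    (hr : ∀ ξ ∈ O, HasGradientAt r (g ξ) ξ) (hg : ContinuousOn g O)
    (weak : ∀ φ : Plane → ℝ, ContDiff ℝ 1 φ → HasCompactSupport φ → tsupport φ ⊆ E →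
      ∫ ξ in E, (inner ℝ (J ξ) (gradient φ ξ) - G ξ * φ ξ) = 0)
    (hM : ∀ ξ ∈ O, 0 ≤ η * inner ℝ (J ξ - r ξ • (ξ - c)) (q ξ))
    (hT : ∀ ξ ∈ O, 0 < η * (G ξ + (2 * r ξ + inner ℝ (g ξ) (ξ - c))))
    (h0 : ∃ ξ ∈ E, u ξ < τ) : False := by
  set K := {ξ ∈ closure E | u ξ ≤ τ} with hKdef
  have huc : ContinuousOn u O := fun ξ hξ => (hu ξ hξ).hasFDerivAt.continuousAt.continuousWithinAt
  have hrc : ContinuousOn r O := fun ξ hξ => (hr ξ hξ).hasFDerivAt.continuousAt.continuousWithinAt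
  have hmaxK : ∀ ξ ∈ O, ξ ∉ K → max (τ - u ξ) 0 = 0 := by
    intro ξ hξ hξK
    refine max_eq_right ?_
    by_contra hlt
    exact hξK ⟨subset_closure (hOE hξ), by linarith⟩
  -- The test function lives on the sublevel set `K`, which is compact in `O`. The indicator
  -- discards other places where `u`, known only near `E`, might be below `τ`.
  set φ : Plane → ℝ := O.indicator fun ξ => max (τ - u ξ) 0 ^ 2 with hφdef
  set Φ : Plane → Plane := O.indicator fun ξ => (-(2 * max (τ - u ξ) 0)) • q ξ with hΦdef
  have hφK : ∀ ξ ∉ K, φ ξ = 0 := by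
    intro ξ hξ
    by_cases hξO : ξ ∈ O
    · rw [hφdef, indicator_of_mem hξO, hmaxK ξ hξO hξ]; norm_num
    · rw [hφdef, indicator_of_notMem hξO]
  have hΦK : ∀ ξ ∉ K, Φ ξ = 0 := by
    intro ξ hξ
    by_cases hξO : ξ ∈ O
    · rw [hΦdef, indicator_of_mem hξO, hmaxK ξ hξO hξ]; simp
    · rw [hΦdef, indicator_of_notMem hξO]
  have hmc : ContinuousOn (fun ξ => max (τ - u ξ) 0) O :=
    (continuousOn_const.sub huc).sup continuousOn_const
  have hφc : ContinuousOn φ O :=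
    (hmc.pow 2).congr fun ξ hξ => by rw [hφdef, indicator_of_mem hξ]; rfl
  have hΦc : ContinuousOn Φ O :=
    (((hmc.const_mul 2).neg).smul hq).congr fun ξ hξ => by
      rw [hΦdef, indicator_of_mem hξ]; rfl
  have hφΦ : ∀ ξ, HasGradientAt φ (Φ ξ) ξ := by
    intro ξ
    by_cases hξ : ξ ∈ K
    · have hξO := hKO hξ
      have h1 : HasFDerivAt (fun ξ => max (τ - u ξ) 0 ^ 2)
          ((2 * max (τ - u ξ) 0) • -(InnerProductSpace.toDual ℝ Plane (q ξ))) ξ :=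
        (hasDerivAt_sq_max (τ - u ξ)).comp_hasFDerivAt (f := fun ξ => τ - u ξ) ξ ((hu ξ hξO).hasFDerivAt.const_sub τ)
      rw [hasGradientAt_iff_hasFDerivAt]
      have h2 : φ =ᶠ[𝓝 ξ] fun ξ => max (τ - u ξ) 0 ^ 2 := by
        filter_upwards [hO.mem_nhds hξO] with y hy
        rw [hφdef, indicator_of_mem hy]
      refine (h1.congr_of_eventuallyEq h2).congr_fderiv ?_
      rw [hΦdef, indicator_of_mem hξO]
      simp
    · have h2 : φ =ᶠ[𝓝 ξ] fun _ => 0 := by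
        filter_upwards [hK.isClosed.isOpen_compl.mem_nhds hξ] with y hy using hφK y hy
      rw [hΦK ξ hξ, hasGradientAt_iff_hasFDerivAt, map_zero]
      exact (hasFDerivAt_const (0 : ℝ) ξ).congr_of_eventuallyEq h2
  have hφsmooth : ContDiff ℝ 1 φ := by
    rw [contDiff_one_iff_hasFDerivAt]
    exact ⟨_, (InnerProductSpace.toDual ℝ Plane).continuous.comp
      (continuous_of_continuousOn_of_eq_zero hO hK.isClosed hKO hΦc hΦK),
      fun ξ => (hφΦ ξ).hasFDerivAt⟩
  have hφs : HasCompactSupport φ := HasCompactSupport.intro hK hφK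
  have hts : tsupport φ ⊆ K := by
    refine closure_minimal (fun ξ hξ => ?_) hK.isClosed
    by_contra hξK
    exact hξ (hφK ξ hξK)
  have hgr : ∀ ξ, gradient φ ξ = Φ ξ := fun ξ => (hφΦ ξ).gradient
  have e1 := weak φ hφsmooth hφs (hts.trans (hKO.trans hOE))
  have e2 := integral_radial_divergence hO hr hg hφsmooth hφs (hts.trans hKO) c
  simp only [hgr] at e1 e2
  rw [setIntegral_eq_integral_of_forall_compl_eq_zero] at e1
  swap
  · intro ξ hξ
    have : ξ ∉ K := fun h => hξ (hOE (hKO h))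
    rw [hφK ξ this, hΦK ξ this]; simp
  have c1 : ContinuousOn (fun ξ => inner ℝ (J ξ) (Φ ξ) - G ξ * φ ξ) O :=
    (hJ.inner hΦc).sub (hG.mul hφc)
  have hid : Continuous fun ξ : Plane => ξ - c := by fun_prop
  have c2 : ContinuousOn (fun ξ => r ξ * inner ℝ (ξ - c) (Φ ξ)
      + (2 * r ξ + inner ℝ (g ξ) (ξ - c)) * φ ξ) O :=
    (hrc.mul (hid.continuousOn.inner hΦc)).add
      (((hrc.const_mul 2).add (hg.inner hid.continuousOn)).mul hφc)
  have z1 : ∀ ξ ∉ K, inner ℝ (J ξ) (Φ ξ) - G ξ * φ ξ = 0 := fun ξ hξ => by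
    rw [hφK ξ hξ, hΦK ξ hξ]; simp
  have z2 : ∀ ξ ∉ K, r ξ * inner ℝ (ξ - c) (Φ ξ)
      + (2 * r ξ + inner ℝ (g ξ) (ξ - c)) * φ ξ = 0 := fun ξ hξ => by
    rw [hφK ξ hξ, hΦK ξ hξ]; simp
  have i1 := integrable_of_continuousOn_of_eq_zero hO hK hKO c1 z1
  have i2 := integrable_of_continuousOn_of_eq_zero hO hK hKO c2 z2
  -- Difference of the weak equation and the divergence identity. Since `∇φ = -2 max (τ - u) 0 • q`,
  -- the factor `-η` makes the flux term nonnegative by `hM` and the zeroth order term nonnegative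
  -- by `hT`, strictly so where `u < τ`. Yet the integral vanishes.
  set D : Plane → ℝ := fun ξ => -η * ((inner ℝ (J ξ) (Φ ξ) - G ξ * φ ξ)
    - (r ξ * inner ℝ (ξ - c) (Φ ξ) + (2 * r ξ + inner ℝ (g ξ) (ξ - c)) * φ ξ)) with hD
  have eD : ∫ ξ, D ξ = 0 := by
    rw [hD, integral_const_mul, integral_sub i1 i2, e1, e2]; simp
  have zD : ∀ ξ ∉ K, D ξ = 0 := fun ξ hξ => by
    simp only [hD]; rw [z1 ξ hξ, z2 ξ hξ]; simp
  have hDc : Continuous D := continuous_of_continuousOn_of_eq_zero hO hK.isClosed hKO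
    (continuousOn_const.mul (c1.sub c2)) zD
  have hDO : ∀ ξ ∈ O, D ξ = 2 * max (τ - u ξ) 0 * (η * inner ℝ (J ξ - r ξ • (ξ - c)) (q ξ))
      + (η * (G ξ + (2 * r ξ + inner ℝ (g ξ) (ξ - c)))) * max (τ - u ξ) 0 ^ 2 := by
    intro ξ hξ
    simp only [hD, hφdef, hΦdef, indicator_of_mem hξ, inner_smul_right, inner_sub_left,
      inner_smul_left]
    simp only [conj_trivial]
    ring
  have hD0 : 0 ≤ D := by
    intro ξ
    by_cases hξ : ξ ∈ O
    · rw [hDO ξ hξ]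
      have := hM ξ hξ
      have := (hT ξ hξ).le
      have := le_max_right (τ - u ξ) 0
      simp only [Pi.zero_apply]
      positivity
    · exact (zD ξ fun h => hξ (hKO h)).ge
  obtain ⟨ξ, hξE, hξ⟩ := h0
  have hξO : ξ ∈ O := hKO ⟨subset_closure hξE, hξ.le⟩
  have hpos : D ξ ≠ 0 := by
    rw [hDO ξ hξO]
    have h1 := hM ξ hξO
    have h2 := hT ξ hξO
    have h3 : 0 < max (τ - u ξ) 0 := lt_max_of_lt_left (by linarith)
    positivity
  have := hDc.integral_pos_of_hasCompactSupport_nonneg_nonzero (μ := volume)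
    (HasCompactSupport.intro hK zD) hD0 hpos
  linarith

/-! ### The weak maximum principle -/

/-- In the pseudo-subsonic region the mass flux is a monotone function of the velocity. -/
theorem eventually_flux_monotone {γ s₀ : ℝ} {z₀ : Plane} (hγ : 1 ≤ γ) (hs₀ : s₀ ∈ enthalpyRange γ)
    (hell : densityDeriv γ s₀ * ‖z₀‖ ^ 2 < density γ s₀) {X : Type*} {l : Filter X}
    {s t : X → ℝ} {z w : X → Plane} (hs : Tendsto s l (𝓝 s₀)) (ht : Tendsto t l (𝓝 s₀))
    (hz : Tendsto z l (𝓝 z₀)) (hw : Tendsto w l (𝓝 z₀))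
    (hst : ∀ x, s x - t x = (‖w x‖ ^ 2 - ‖z x‖ ^ 2) / 2) :
    ∀ᶠ x in l, 0 ≤ inner ℝ (density γ (s x) • z x - density γ (t x) • w x) (z x - w x) := by
  -- Strict ellipticity leaves room for a constant slightly above `dρ/dπ`, which is a Lipschitz
  -- constant of the density near `s₀`.
  obtain ⟨Λ, hΛ1, hΛ2⟩ : ∃ Λ : ℝ, Λ * ‖z₀‖ ^ 2 < density γ s₀ ∧ densityDeriv γ s₀ < Λ := by
    have hc : Tendsto (fun Λ : ℝ => Λ * ‖z₀‖ ^ 2) (𝓝[>] densityDeriv γ s₀)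
        (𝓝 (densityDeriv γ s₀ * ‖z₀‖ ^ 2)) :=
      (tendsto_id.mul_const _).mono_left nhdsWithin_le_nhds
    exact ((hc.eventually (gt_mem_nhds hell)).and self_mem_nhdsWithin).exists
  have hΛ0 : 0 < Λ := (densityDeriv_pos hγ hs₀).trans hΛ2
  lift Λ to NNReal using hΛ0.le
  obtain ⟨S, hS, hLip⟩ := (hasStrictDerivAt_density hγ hs₀).hasStrictFDerivAt
    |>.exists_lipschitzOnWith_of_nnnorm_lt Λ (by
      rw [← NNReal.coe_lt_coe]
      simpa [abs_of_pos (densityDeriv_pos hγ hs₀)] using hΛ2)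
  have hcd := continuousAt_density hγ hs₀
  have hlim : Tendsto (fun x => (density γ (s x) + density γ (t x)) / 2
      - Λ * ‖z x + w x‖ ^ 2 / 4) l
      (𝓝 ((density γ s₀ + density γ s₀) / 2 - Λ * ‖z₀ + z₀‖ ^ 2 / 4)) :=
    (((hcd.tendsto.comp hs).add (hcd.tendsto.comp ht)).div_const 2).sub
      ((((hz.add hw).norm.pow 2).const_mul (Λ : ℝ)).div_const 4)
  have hpos : 0 < (density γ s₀ + density γ s₀) / 2 - Λ * ‖z₀ + z₀‖ ^ 2 / 4 := by
    rw [← two_smul ℝ z₀, norm_smul]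
    norm_num
    nlinarith
  filter_upwards [hs.eventually hS, ht.eventually hS, hlim.eventually (lt_mem_nhds hpos)]
    with x h1 h2 h3
  have hL := hLip.dist_le_mul _ h1 _ h2
  rw [Real.dist_eq, Real.dist_eq, hst] at hL
  set ρ := density γ (s x)
  set r := density γ (t x)
  have e1 : ‖z x‖ ^ 2 - ‖w x‖ ^ 2 = inner ℝ (z x - w x) (z x + w x) := by
    simp only [inner_sub_left, inner_add_right, real_inner_self_eq_norm_sq,
      real_inner_comm (z x) (w x)]
    ring
  -- Symmetric splitting into mean density and density difference. The second term is at least `-Λ /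
  -- 4 ‖z + w‖² ‖z - w‖²`, by the Lipschitz bound and Cauchy-Schwarz, and the first absorbs it
  -- because `‖z + w‖² / 4` tends to `‖z₀‖²`.
  have e2 : inner ℝ (ρ • z x - r • w x) (z x - w x)
      = (ρ + r) / 2 * ‖z x - w x‖ ^ 2 + (ρ - r) / 2 * (‖z x‖ ^ 2 - ‖w x‖ ^ 2) := by
    rw [@norm_sub_sq_real]
    simp only [inner_sub_left, inner_sub_right, inner_smul_left, real_inner_self_eq_norm_sq,
      real_inner_comm (z x) (w x), conj_trivial]
    ring
  have hcs := abs_real_inner_le_norm (z x - w x) (z x + w x)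
  rw [← e1] at hcs
  rw [e2]
  set d := ‖z x‖ ^ 2 - ‖w x‖ ^ 2
  have hd : |(‖w x‖ ^ 2 - ‖z x‖ ^ 2) / 2| = |d| / 2 := by
    rw [abs_div, abs_sub_comm]; norm_num [d]
  rw [hd] at hL
  have h4 : -(Λ * d ^ 2 / 4) ≤ (ρ - r) / 2 * d := by
    have h5 : |(ρ - r) / 2 * d| ≤ Λ * d ^ 2 / 4 := by
      rw [abs_mul, abs_div, abs_two, ← sq_abs d]
      nlinarith [abs_nonneg d, mul_le_mul_of_nonneg_right hL (abs_nonneg d)]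
    exact (abs_le.1 h5).1
  have h6 : d ^ 2 ≤ ‖z x - w x‖ ^ 2 * ‖z x + w x‖ ^ 2 := by
    rw [← sq_abs d, ← mul_pow]
    exact pow_le_pow_left₀ (abs_nonneg d) hcs 2
  nlinarith [mul_nonneg h3.le (sq_nonneg ‖z x - w x‖), mul_le_mul_of_nonneg_left h6 hΛ0.le]

/-- On the compact set `C \ O` the minimum of `u` exceeds `m`, so any level in between serves. This
localizes the comparison to a neighbourhood of the minimum set. -/
theorem exists_sublevel_subset {X : Type*} [TopologicalSpace X] {C O : Set X} {u : X → ℝ} {m : ℝ}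
    (hC : IsCompact C) (hO : IsOpen O) (hu : ContinuousOn u C)
    (h : ∀ x ∈ C, x ∉ O → m < u x) : ∃ τ, m < τ ∧ {x ∈ C | u x ≤ τ} ⊆ O := by
  rcases (C \ O).eq_empty_or_nonempty with he | hne
  · exact ⟨m + 1, by linarith, fun x hx => by_contra fun hxO =>
      (he ▸ (⟨hx.1, hxO⟩ : x ∈ C \ O) : x ∈ (∅ : Set X))⟩
  · obtain ⟨x₀, hx₀, hmin⟩ := (hC.diff hO).exists_isMinOn hne (hu.mono sdiff_subset)
    have h1 := h x₀ hx₀.1 hx₀.2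
    refine ⟨(m + u x₀) / 2, by linarith, fun x hx => by_contra fun hxO => ?_⟩
    have h2 : u x₀ ≤ u x := hmin ⟨hx.1, hxO⟩
    have h3 := hx.2
    linarith

theorem ConstState.hasGradientAt_potential (ℓ : ConstState) (ξ : Plane) :
    HasGradientAt ℓ.potential ℓ.v ξ := by
  rw [hasGradientAt_iff_hasFDerivAt]
  exact ((InnerProductSpace.toDual ℝ Plane ℓ.v).hasFDerivAt).const_add ℓ.k

theorem hasGradientAt_norm_sub_sq (c ξ : Plane) :
    HasGradientAt (fun ξ : Plane => ‖ξ - c‖ ^ 2 / 2) (ξ - c) ξ := by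
  rw [hasGradientAt_iff_hasFDerivAt]
  have h := (((hasFDerivAt_id ξ).sub_const c).norm_sq).mul_const (2⁻¹ : ℝ)
  simp only [← div_eq_mul_inv] at h
  refine h.congr_fderiv ?_
  ext x
  simp

theorem HasGradientAt.linear_combination {f g : Plane → ℝ} {f' g' ξ : Plane} (hf : HasGradientAt f f' ξ)
    (hg : HasGradientAt g g' ξ) (a b : ℝ) :
    HasGradientAt (fun x => a * f x + b * g x) (a • f' + b • g') ξ := by
  rw [hasGradientAt_iff_hasFDerivAt] at *
  refine ((hf.const_mul a).add (hg.const_mul b)).congr_fderiv ?_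
  simp

/-- Comparison with strictly convex or concave perturbations of constant states. -/
theorem no_strict_interior_min {γ : ℝ} {E : Set Plane} {ψ : Plane → ℝ} {v : Plane → Plane}
    (hγ : 1 ≤ γ) (hE : IsOpen E) (hb : Bornology.IsBounded E) (hc1 : IsC1On (closure E) ψ v)
    (hpos : ∀ ξ ∈ E, HasPositiveDensity γ (ψ ξ) (v ξ) ξ) (hw : IsWeakSolution γ E ψ v)
    (hell : ∀ ξ ∈ E, IsPseudoSubsonic γ (ψ ξ) (v ξ) ξ) (ℓ : ConstState) {η δ : ℝ}
    (hη : η = 1 ∨ η = -1) (hδ : 0 < δ) {ξ₁ : Plane} (hξ₁ : ξ₁ ∈ E) :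
    ¬ ∀ ξ ∈ frontier E, η * (ψ ξ₁ - ℓ.potential ξ₁) - δ * (‖ξ₁ - ℓ.v‖ ^ 2 / 2)
      < η * (ψ ξ - ℓ.potential ξ) - δ * (‖ξ - ℓ.v‖ ^ 2 / 2) := by
  intro hfr
  have hηη : η * η = 1 := by rcases hη with rfl | rfl <;> norm_num
  set u : Plane → ℝ := fun ξ => η * (ψ ξ - ℓ.potential ξ) - δ * (‖ξ - ℓ.v‖ ^ 2 / 2) with hu
  set θ := η * δ with hθ
  have hC : IsCompact (closure E) := hb.isCompact_closure
  have hψg : ∀ ξ ∈ E, HasGradientAt ψ (v ξ) ξ := fun ξ hξ => by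
    have := (hc1.1 ξ (subset_closure hξ)).hasFDerivWithinAt.hasFDerivAt
      (mem_of_superset (hE.mem_nhds hξ) subset_closure)
    exact this
  have hψc : ContinuousOn ψ (closure E) := fun ξ hξ =>
    (hc1.1 ξ hξ).hasFDerivWithinAt.continuousWithinAt
  have hvc : ContinuousOn v E := hc1.2.mono subset_closure
  have hpc : Continuous ℓ.potential := by unfold ConstState.potential; fun_prop
  have huc : ContinuousOn u (closure E) := by
    have h1 : Continuous fun ξ : Plane => δ * (‖ξ - ℓ.v‖ ^ 2 / 2) := by fun_prop
    exact ((hψc.sub hpc.continuousOn).const_mul η).sub h1.continuousOn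
  obtain ⟨ξ₀, hξ₀, hmin⟩ := hC.exists_isMinOn ⟨ξ₁, subset_closure hξ₁⟩ huc
  have hmin : ∀ ξ ∈ closure E, u ξ₀ ≤ u ξ := fun ξ hξ => hmin hξ
  have hKE : ∀ ξ ∈ closure E, u ξ = u ξ₀ → ξ ∈ E := by
    intro ξ hξ he
    by_contra hξE
    have h1 := hfr ξ ⟨hξ, by rwa [hE.interior_eq]⟩
    have h2 := hmin ξ₁ (subset_closure hξ₁)
    change u ξ₁ < u ξ at h1
    linarith
  set q : Plane → Plane := fun ξ => η • (v ξ - ℓ.v) - δ • (ξ - ℓ.v) with hq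
  have hug : ∀ ξ ∈ E, HasGradientAt u (q ξ) ξ := by
    intro ξ hξ
    have h1 := ((hψg ξ hξ).linear_combination (ℓ.hasGradientAt_potential ξ) 1 (-1)).linear_combination
      (hasGradientAt_norm_sub_sq ℓ.v ξ) η (-δ)
    convert h1 using 1
    · funext x; simp only [hu]; ring
    · simp only [hq]; module
  -- The comparison function `ℓ + θ ‖ξ - ℓ.v‖² / 2` has radial pseudo-velocity `-(1 - θ) (ξ - ℓ.v)`.
  -- Its enthalpy is formed with the value of `ψ` rather than its own, so that the two enthalpies
  -- differ only through the velocities and no zeroth order term appears. Since `ψ` is `C¹`, the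
  -- comparison flux is then a `C¹` field and its divergence can be computed classically.
  set sL : Plane → ℝ := fun ξ => -(ψ ξ - ‖ξ‖ ^ 2 / 2) - (1 - θ) ^ 2 * (‖ξ - ℓ.v‖ ^ 2 / 2) with hsL
  set g : Plane → Plane := fun ξ => -(v ξ - ξ) - (1 - θ) ^ 2 • (ξ - ℓ.v) with hg
  have hsg : ∀ ξ ∈ E, HasGradientAt sL (g ξ) ξ := by
    intro ξ hξ
    have h1 := ((hψg ξ hξ).linear_combination (hasGradientAt_norm_sub_sq 0 ξ) (-1) 1).linear_combination
      (hasGradientAt_norm_sub_sq ℓ.v ξ) 1 (-(1 - θ) ^ 2)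
    convert h1 using 1
    · funext x; simp only [hsL, sub_zero]; ring
    · simp only [hg, sub_zero]; module
  have hgc : ContinuousOn g E := by
    have h1 : Continuous fun ξ : Plane => (1 - θ) ^ 2 • (ξ - ℓ.v) := by fun_prop
    exact (hvc.sub continuousOn_id).neg.sub h1.continuousOn
  have hqc : ContinuousOn q E := by
    have h1 : Continuous fun ξ : Plane => δ • (ξ - ℓ.v) := by fun_prop
    exact ((hvc.sub continuousOn_const).const_smul η).sub h1.continuousOn
  set s : Plane → ℝ := fun ξ => enthalpyAt (ψ ξ) (v ξ) ξ with hs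
  set J : Plane → Plane := fun ξ => density γ (s ξ) • (v ξ - ξ) with hJ
  set G : Plane → ℝ := fun ξ => 2 * density γ (s ξ) with hG
  set r : Plane → ℝ := fun ξ => -(1 - θ) * density γ (sL ξ) with hr
  set gr : Plane → Plane := fun ξ => (-(1 - θ) * densityDeriv γ (sL ξ)) • g ξ with hgr
  set B : Set Plane := {ξ | ξ ∈ E ∧ sL ξ ∈ enthalpyRange γ ∧
    0 ≤ η * inner ℝ (J ξ - r ξ • (ξ - ℓ.v)) (q ξ) ∧
    0 < η * (G ξ + (2 * r ξ + inner ℝ (gr ξ) (ξ - ℓ.v)))} with hB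
  have hψE : ContinuousOn ψ E := hψc.mono subset_closure
  have hsc : ContinuousOn s E := by
    have h1 : Continuous fun ξ : Plane => ‖ξ‖ ^ 2 / 2 := by fun_prop
    exact (hψE.sub h1.continuousOn).neg.sub (((hvc.sub continuousOn_id).norm.pow 2).div_const 2)
  have hsLc : ContinuousOn sL E := fun ξ hξ =>
    (hsg ξ hξ).hasFDerivAt.continuousAt.continuousWithinAt
  have hdens : ∀ ξ ∈ E, ContinuousAt (fun ξ => density γ (s ξ)) ξ := fun ξ hξ =>
    (continuousAt_density hγ (hpos ξ hξ)).comp (f := s) (hsc.continuousAt (hE.mem_nhds hξ))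
  have hdensL : ∀ ξ ∈ E, sL ξ ∈ enthalpyRange γ → ContinuousAt (fun ξ => density γ (sL ξ)) ξ :=
    fun ξ hξ hp => (continuousAt_density hγ hp).comp (f := sL) (hsLc.continuousAt (hE.mem_nhds hξ))
  have hgrc : ∀ ξ ∈ E, sL ξ ∈ enthalpyRange γ → ContinuousAt gr ξ := fun ξ hξ hp =>
    (continuousAt_const.mul ((continuousAt_densityDeriv hγ hp).comp (f := sL)
      (hsLc.continuousAt (hE.mem_nhds hξ)))).smul (hgc.continuousAt (hE.mem_nhds hξ))
  have hrg : ∀ ξ ∈ E, sL ξ ∈ enthalpyRange γ → HasGradientAt r (gr ξ) ξ := by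
    intro ξ hξ hp
    have h1 := ((hasStrictDerivAt_density hγ hp).hasDerivAt.comp_hasFDerivAt (f := sL) ξ
      (hsg ξ hξ).hasFDerivAt).const_mul (-(1 - θ))
    rw [hasGradientAt_iff_hasFDerivAt]
    refine h1.congr_fderiv ?_
    simp only [hgr, map_smul, smul_smul]
  have hK : ∀ ξ ∈ closure E, u ξ = u ξ₀ → ξ ∈ interior B := by
    intro ξ hξ he
    have hξE := hKE ξ hξ he
    -- At a minimum the velocities of `ψ` and of the comparison function agree, hence also the two
    -- enthalpies.
    have hq0 : q ξ = 0 := by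
      have hlm : IsLocalMin u ξ := by
        filter_upwards [hE.mem_nhds hξE] with x hx
        rw [he]; exact hmin x (subset_closure hx)
      have := hlm.hasFDerivAt_eq_zero (hug ξ hξE).hasFDerivAt
      simpa using this
    have hz : v ξ - ξ = -((1 - θ) • (ξ - ℓ.v)) := by
      have h1 : η • q ξ = 0 := by rw [hq0, smul_zero]
      simp only [hq, smul_sub, smul_smul, hηη, one_smul] at h1
      rw [← smul_sub, ← hθ] at h1
      have h2 : v ξ = ℓ.v + θ • (ξ - ℓ.v) := by
        rw [← sub_eq_zero, ← h1]; module
      rw [h2]; module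
    have hss : sL ξ = s ξ := by
      simp only [hsL, hs, enthalpyAt]
      rw [hz, norm_neg, norm_smul, mul_pow, Real.norm_eq_abs, sq_abs]
      ring
    have hp : sL ξ ∈ enthalpyRange γ := by rw [hss]; exact hpos ξ hξE
    have hsub := (pseudoSubsonic_iff hγ (hpos ξ hξE)).1 (hell ξ hξE)
    change densityDeriv γ (s ξ) * ‖v ξ - ξ‖ ^ 2 < density γ (s ξ) at hsub
    have hR' := densityDeriv_pos hγ (hpos ξ hξE)
    have hR := density_pos hγ (hpos ξ hξE)
    rw [mem_interior_iff_mem_nhds]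
    have hM := eventually_flux_monotone (l := 𝓝 ξ) (s := s) (t := sL) (z := fun ξ => v ξ - ξ)
      (w := fun ξ => -((1 - θ) • (ξ - ℓ.v))) hγ (hpos ξ hξE) hsub
      (hsc.continuousAt (hE.mem_nhds hξE))
      (by change Tendsto sL (𝓝 ξ) (𝓝 (s ξ)); rw [← hss]; exact hsLc.continuousAt (hE.mem_nhds hξE))
      ((hvc.sub continuousOn_id).continuousAt (hE.mem_nhds hξE))
      (by
        rw [hz]
        have : Continuous fun ξ : Plane => -((1 - θ) • (ξ - ℓ.v)) := by fun_prop
        exact this.tendsto ξ)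
      (fun x => by
        simp only [hsL, hs, enthalpyAt]
        rw [norm_neg, norm_smul, mul_pow, Real.norm_eq_abs, sq_abs]
        ring)
    have hT : ∀ᶠ x in 𝓝 ξ, 0 < η * (G x + (2 * r x + inner ℝ (gr x) (x - ℓ.v))) := by
      have hid : Continuous fun ξ : Plane => ξ - ℓ.v := by fun_prop
      have hcont : ContinuousAt
          (fun x => η * (G x + (2 * r x + inner ℝ (gr x) (x - ℓ.v)))) ξ :=
        continuousAt_const.mul (((hdens ξ hξE).const_mul 2).add
          ((((hdensL ξ hξE hp).const_mul (-(1 - θ))).const_mul 2).add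
            ((hgrc ξ hξE hp).inner hid.continuousAt)))
      refine hcont.eventually (lt_mem_nhds ?_)
      have hgξ : g ξ = ((1 - θ) * θ) • (ξ - ℓ.v) := by
        simp only [hg]; rw [hz]; module
      have hnz : ‖v ξ - ξ‖ ^ 2 = (1 - θ) ^ 2 * ‖ξ - ℓ.v‖ ^ 2 := by
        rw [hz, norm_neg, norm_smul, mul_pow, Real.norm_eq_abs, sq_abs]
      -- Ellipticity bounds `dρ/dπ |z|²` by `ρ < 2 ρ`, so this is positive; without the perturbation
      -- (`δ = 0`) it would vanish.
      have hcalc : η * (G ξ + (2 * r ξ + inner ℝ (gr ξ) (ξ - ℓ.v)))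
          = δ * (2 * density γ (s ξ) - densityDeriv γ (s ξ) * ‖v ξ - ξ‖ ^ 2) := by
        simp only [hG, hr, hgr, hss, hgξ, hnz, inner_smul_left, real_inner_self_eq_norm_sq,
          conj_trivial]
        have : δ = η * θ := by rw [hθ, ← mul_assoc, hηη, one_mul]
        rw [this]; ring
      beta_reduce
      rw [hcalc]
      exact mul_pos hδ (by linarith)
    have hpn : ∀ᶠ x in 𝓝 ξ, sL x ∈ enthalpyRange γ :=
      (hsLc.continuousAt (hE.mem_nhds hξE)).eventually ((isOpen_enthalpyRange hγ).mem_nhds hp)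
    filter_upwards [hE.mem_nhds hξE, hpn, hM, hT] with x h1 h2 h3 h4
    refine ⟨h1, h2, ?_, h4⟩
    have e1 : q x = η • (v x - x - -((1 - θ) • (x - ℓ.v))) := by
      have : δ = η * θ := by rw [hθ, ← mul_assoc, hηη, one_mul]
      simp only [hq]; rw [this]; module
    have e2 : J x - r x • (x - ℓ.v)
        = density γ (s x) • (v x - x) - density γ (sL x) • -((1 - θ) • (x - ℓ.v)) := by
      simp only [hJ, hr]; module
    rw [e1, e2, inner_smul_right, ← mul_assoc, hηη, one_mul]
    exact h3
  obtain ⟨τ, hτ, hsub⟩ := exists_sublevel_subset hC (isOpen_interior (s := B)) huc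
    (m := u ξ₀) fun x hx hxO => lt_of_le_of_ne (hmin x hx) fun h => hxO (hK x hx h.symm)
  have hOE : interior B ⊆ E := fun x hx => (interior_subset hx).1
  have hKc : IsCompact {ξ ∈ closure E | u ξ ≤ τ} :=
    hC.of_isClosed_subset (huc.preimage_isClosed_of_isClosed isClosed_closure isClosed_Iic)
      fun x hx => hx.1
  refine false_of_strict_comparison (E := E) (O := interior B) (J := J) (q := q) (g := gr)
    (G := G) (u := u) (r := r) (c := ℓ.v) (τ := τ) (η := η) isOpen_interior hOE hKc hsub
    (fun ξ hξ => hug ξ (hOE hξ)) (hqc.mono hOE) ?_ ?_ ?_ ?_ ?_ ?_ ?_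
    ⟨ξ₀, hKE ξ₀ hξ₀ rfl, hτ⟩
  · exact fun ξ hξ => ((hdens ξ (hOE hξ)).continuousWithinAt).smul
      (((hvc.sub continuousOn_id) ξ (hOE hξ)).mono hOE)
  · exact fun ξ hξ => ((hdens ξ (hOE hξ)).const_mul 2).continuousWithinAt
  · exact fun ξ hξ => hrg ξ (hOE hξ) (interior_subset hξ).2.1
  · exact fun ξ hξ => (hgrc ξ (hOE hξ) (interior_subset hξ).2.1).continuousWithinAt
  · intro φ h1 h2 h3
    rw [← hw φ h1 h2 h3]
    refine integral_congr_ae (Eventually.of_forall fun ξ => ?_)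
    simp only [hJ, hG, hs, flowDensity, inner_smul_left, conj_trivial]
  · exact fun ξ hξ => (interior_subset hξ).2.2.1
  · exact fun ξ hξ => (interior_subset hξ).2.2.2

/-- Weak maximum principle: the difference between the potential and an affine function attains its
extrema on the boundary. -/
theorem weak_maximum_principle {γ : ℝ} {E : Set Plane} {ψ : Plane → ℝ} {v : Plane → Plane}
    (hγ : 1 ≤ γ) (hE : IsOpen E) (hb : Bornology.IsBounded E) (hc1 : IsC1On (closure E) ψ v)
    (hpos : ∀ ξ ∈ E, HasPositiveDensity γ (ψ ξ) (v ξ) ξ) (hw : IsWeakSolution γ E ψ v)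
    (hell : ∀ ξ ∈ E, IsPseudoSubsonic γ (ψ ξ) (v ξ) ξ) (ℓ : ConstState) {η M : ℝ}
    (hη : η = 1 ∨ η = -1) (hM : ∀ ξ ∈ frontier E, M ≤ η * (ψ ξ - ℓ.potential ξ)) :
    ∀ ξ ∈ closure E, M ≤ η * (ψ ξ - ℓ.potential ξ) := by
  intro ξ hξ
  by_contra hlt
  push Not at hlt
  have hξE : ξ ∈ E := by
    by_contra h
    exact absurd (hM ξ ⟨hξ, by rwa [hE.interior_eq]⟩) (not_le.2 hlt)
  obtain ⟨C, hC⟩ := hb.closure.subset_closedBall ℓ.v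
  have hC' : ∀ x ∈ closure E, ‖x - ℓ.v‖ ^ 2 / 2 ≤ C ^ 2 / 2 := fun x hx => by
    have h1 : ‖x - ℓ.v‖ ≤ C := by simpa [dist_eq_norm] using hC hx
    have := pow_le_pow_left₀ (norm_nonneg _) h1 2
    linarith
  set D := M - η * (ψ ξ - ℓ.potential ξ) with hD
  have hD0 : 0 < D := by linarith
  -- So small that the quadratic perturbation, at most `δ C² / 2` on the closure, cannot make up for
  -- the deficit `D`.
  set δ := D / (C ^ 2 + 1) with hδ
  have hδ0 : 0 < δ := by positivity
  refine no_strict_interior_min hγ hE hb hc1 hpos hw hell ℓ hη hδ0 hξE fun x hx => ?_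
  have h1 := mul_le_mul_of_nonneg_left (hC' x (frontier_subset_closure hx)) hδ0.le
  have h2 : 0 ≤ δ * (‖ξ - ℓ.v‖ ^ 2 / 2) := by positivity
  have h3 : δ * (C ^ 2 + 1) = D := by rw [hδ]; field_simp
  have h4 := hM x hx
  nlinarith

/-! ### Plane geometry -/

/-- The matrix with rows `a` and `n` is orthogonal, hence so is its transpose; the column relations
are `h4`, `h5` and `h6`. -/
theorem plane_inner_eq {a n : Plane} (ha : ‖a‖ = 1) (hn : ‖n‖ = 1) (han : inner ℝ n a = 0)
    (x y : Plane) :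
    inner ℝ x y = inner ℝ x a * inner ℝ y a + inner ℝ x n * inner ℝ y n := by
  have h1 : inner ℝ a a = 1 := by rw [real_inner_self_eq_norm_sq, ha]; norm_num
  have h2 : inner ℝ n n = 1 := by rw [real_inner_self_eq_norm_sq, hn]; norm_num
  rw [plane_inner] at h1 h2 han
  simp only [plane_inner]
  have h3 : a 0 ^ 2 = n 1 ^ 2 := by
    have e : (a 0 * a 0 + a 1 * a 1) * n 1 ^ 2 + n 0 * a 0 * (n 0 * a 0 + n 1 * a 1)
      - n 1 * a 1 * (n 0 * a 0 + n 1 * a 1) = a 0 ^ 2 * (n 0 * n 0 + n 1 * n 1) := by ring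
    rw [h1, h2, han] at e
    linarith
  have h4 : a 1 ^ 2 + n 1 ^ 2 = 1 := by nlinarith
  have h5 : a 0 ^ 2 + n 0 ^ 2 = 1 := by nlinarith
  have h6 : a 0 * a 1 + n 0 * n 1 = 0 := by
    have e : (n 0 * a 0 + n 1 * a 1) * (a 0 * n 1 + n 0 * a 1) =
      a 0 * a 1 * (n 0 * n 0 + n 1 * n 1) + n 0 * n 1 * (a 0 * a 0 + a 1 * a 1) := by ring
    rw [h1, h2, han] at e
    linarith
  linear_combination (-(x 0 * y 0)) * h5 - (x 1 * y 1) * h4 - (x 0 * y 1 + x 1 * y 0) * h6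

theorem eq_of_inner_eq {a n : Plane} (ha : ‖a‖ = 1) (hn : ‖n‖ = 1) (han : inner ℝ n a = 0)
    {x y : Plane} (h1 : inner ℝ x a = inner ℝ y a) (h2 : inner ℝ x n = inner ℝ y n) : x = y := by
  rw [← sub_eq_zero, ← inner_self_eq_zero (𝕜 := ℝ), plane_inner_eq ha hn han, inner_sub_left,
    inner_sub_left, h1, h2]
  simp

theorem eq_smul_of_perp {n t x : Plane} (hn : ‖n‖ = 1) (ht : t ≠ 0) (hnt : inner ℝ n t = 0)
    (hx : inner ℝ x t = 0) : x = inner ℝ x n • n := by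
  have ht' : ‖t‖ ≠ 0 := norm_ne_zero_iff.2 ht
  have h1 : ‖(‖t‖⁻¹ • t)‖ = 1 := by rw [norm_smul, norm_inv, norm_norm, inv_mul_cancel₀ ht']
  refine eq_of_inner_eq h1 hn (by rw [inner_smul_right, hnt, mul_zero]) ?_ ?_
  · rw [inner_smul_right, inner_smul_right, inner_smul_left, hx, hnt]; simp
  · rw [inner_smul_left, real_inner_self_eq_norm_sq, hn]; simp

/-- A vector with nonpositive products with the outer normals of a convex corner is a
combination of the directions of its sides. -/
theorem exists_cone_combination {a b nA nB : Plane} (ha : ‖a‖ = 1) (hnA : ‖nA‖ = 1)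
    (hA : inner ℝ nA a = 0) (hB : inner ℝ nB b = 0) (hAb : inner ℝ nA b < 0)
    (hBa : inner ℝ nB a < 0) {y : Plane} (h1 : inner ℝ nA y ≤ 0) (h2 : inner ℝ nB y ≤ 0) :
    ∃ α β : ℝ, 0 ≤ α ∧ 0 ≤ β ∧ y = α • a + β • b := by
  refine ⟨inner ℝ nB y / inner ℝ nB a, inner ℝ nA y / inner ℝ nA b,
    div_nonneg_of_nonpos h2 hBa.le, div_nonneg_of_nonpos h1 hAb.le, ?_⟩
  set α := inner ℝ nB y / inner ℝ nB a with hα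
  set β := inner ℝ nA y / inner ℝ nA b with hβ
  have e1 : inner ℝ nA (y - (α • a + β • b)) = 0 := by
    rw [inner_sub_right, inner_add_right, inner_smul_right, inner_smul_right, hA, hβ,
      div_mul_cancel₀ _ hAb.ne]
    ring
  have e2 : inner ℝ nB (y - (α • a + β • b)) = 0 := by
    rw [inner_sub_right, inner_add_right, inner_smul_right, inner_smul_right, hB, hα,
      div_mul_cancel₀ _ hBa.ne]
    ring
  rw [← sub_eq_zero]
  refine eq_of_inner_eq ha hnA hA ?_ (by rw [real_inner_comm, e1, inner_zero_left])
  rw [plane_inner_eq ha hnA hA, real_inner_comm nA (y - (α • a + β • b)), e1, mul_zero,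
    add_zero] at e2
  rw [inner_zero_left]
  exact (mul_eq_zero.1 e2).resolve_left hBa.ne

/-- A connected set that avoids the frontier lies either in `E` or in the exterior of `E`. -/
theorem Convex.subset_of_disjoint_frontier {E C : Set Plane} (hC : Convex ℝ C)
    (hE : IsOpen E) (hfr : ∀ x ∈ C, x ∉ frontier E) (hne : (C ∩ E).Nonempty) : C ⊆ E := by
  have h := hC.isPreconnected.subset_or_subset hE isClosed_closure.isOpen_compl
    (disjoint_compl_right.mono_left subset_closure) (fun x hx => by
      by_cases hxE : x ∈ E
      · exact Or.inl hxE
      · refine Or.inr fun hxc => hfr x hx ⟨hxc, by rwa [hE.interior_eq]⟩)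
  refine h.resolve_right fun h' => ?_
  obtain ⟨x, hxC, hxE⟩ := hne
  exact h' hxC (subset_closure hxE)

theorem convex_ball_inter_halfPlane (x₀ p m : Plane) (r : ℝ) :
    Convex ℝ (Metric.ball x₀ r ∩ {x | inner ℝ m (x - p) < 0}) := by
  refine (convex_ball x₀ r).inter ?_
  have : {x : Plane | inner ℝ m (x - p) < 0} = {x | innerSL ℝ m x < inner ℝ m p} := by
    ext x; simp [inner_sub_right]
  rw [this]
  exact convex_halfSpace_lt (innerSL ℝ m).isLinear _

/-- Near a boundary point on a straight wall, an open set on one side of the wall is a full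
half disc, if it has no other boundary points there. -/
theorem eventually_mem_of_wall {E : Set Plane} {m p x₀ : Plane} (hE : IsOpen E)
    (hside : ∀ x ∈ E, inner ℝ m (x - p) < 0) (hx₀ : x₀ ∈ closure E)
    (hfr : ∀ᶠ x in 𝓝 x₀, x ∈ frontier E → 0 ≤ inner ℝ m (x - p)) :
    ∀ᶠ x in 𝓝 x₀, inner ℝ m (x - p) < 0 → x ∈ E := by
  obtain ⟨r, hr, hball⟩ := Metric.eventually_nhds_iff_ball.1 hfr
  have hsub := (convex_ball_inter_halfPlane x₀ p m r).subset_of_disjoint_frontier hE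
    (fun x hx hxf => absurd (hball x hx.1 hxf) (not_le.2 hx.2)) (by
      obtain ⟨y, hyE, hy⟩ := Metric.mem_closure_iff.1 hx₀ r hr
      exact ⟨y, ⟨by rwa [Metric.mem_ball, dist_comm], hside y hyE⟩, hyE⟩)
  filter_upwards [Metric.ball_mem_nhds x₀ hr] with x hx hm using hsub ⟨hx, hm⟩

theorem tendsto_add_smul (x d : Plane) :
    Tendsto (fun t : ℝ => x + t • d) (𝓝[>] 0) (𝓝 x) := by
  have : Continuous fun t : ℝ => x + t • d := by fun_prop
  have h := this.tendsto 0
  simp only [zero_smul, add_zero] at h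
  exact h.mono_left nhdsWithin_le_nhds

theorem eventually_mem_of_wall_direction {E : Set Plane} {m p x₀ : Plane} (hm : ‖m‖ = 1)
    (hE : IsOpen E) (hside : ∀ x ∈ E, inner ℝ m (x - p) < 0) (hx₀ : x₀ ∈ closure E)
    (hx₀m : inner ℝ m (x₀ - p) = 0)
    (hfr : ∀ᶠ x in 𝓝 x₀, x ∈ frontier E → 0 ≤ inner ℝ m (x - p)) :
    ∀ᶠ t in 𝓝[>] (0 : ℝ), x₀ + t • (-m) ∈ closure E := by
  filter_upwards [(tendsto_add_smul x₀ (-m)).eventually (eventually_mem_of_wall hE hside hx₀ hfr),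
    self_mem_nhdsWithin] with t ht ht0
  refine subset_closure (ht ?_)
  rw [add_sub_right_comm, inner_add_right, hx₀m, inner_smul_right, inner_neg_right,
    real_inner_self_eq_norm_sq, hm]
  have : (0 : ℝ) < t := ht0
  linarith

theorem eventually_mem_segment {K : Set Plane} {x y : Plane} (h : segment ℝ x y ⊆ K) :
    ∀ᶠ t in 𝓝[>] (0 : ℝ), x + t • (y - x) ∈ K := by
  filter_upwards [self_mem_nhdsWithin, Ioo_mem_nhdsGT (zero_lt_one' ℝ)] with t _ ht
  refine h ?_
  rw [segment_eq_image']
  exact ⟨t, ⟨ht.1.le, ht.2.le⟩, rfl⟩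

/-! ### First order conditions at minima -/

theorem inner_nonneg_of_min {K : Set Plane} {u : Plane → ℝ} {q x₀ d : Plane}
    (hu : HasGradientWithinAt u q K x₀) (hmin : ∀ x ∈ K, u x₀ ≤ u x)
    (hd : ∀ᶠ t in 𝓝[>] (0 : ℝ), x₀ + t • d ∈ K) : 0 ≤ inner ℝ q d := by
  have h1 : IsLocalMinOn u K x₀ := eventually_nhdsWithin_of_forall hmin
  have h2 := h1.hasFDerivWithinAt_nonneg hu.hasFDerivWithinAt
    (mem_posTangentConeAt_of_frequently_mem hd.frequently)
  simpa using h2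

theorem hasDerivWithinAt_comp_curve {K : Set Plane} {u : Plane → ℝ} {q : Plane} {σ : ℝ → Plane}
    {I : Set ℝ} {s : ℝ} {t : Plane} (hu : HasGradientWithinAt u q K (σ s))
    (hσ : HasDerivWithinAt σ t I s) (hK : MapsTo σ I K) :
    HasDerivWithinAt (fun s => u (σ s)) (inner ℝ q t) I s := by
  exact (hu.hasFDerivWithinAt.comp_hasDerivWithinAt s hσ hK).congr_deriv (by simp)

theorem inner_nonpos_of_curve_end {K : Set Plane} {u : Plane → ℝ} {q t : Plane} {σ : ℝ → Plane}
    (hu : HasGradientWithinAt u q K (σ 1)) (hσ : HasDerivWithinAt σ t (Icc 0 1) 1)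
    (hK : MapsTo σ (Icc 0 1) K) (hmin : ∀ x ∈ K, u (σ 1) ≤ u x) : inner ℝ q t ≤ 0 := by
  have h1 := hasDerivWithinAt_comp_curve hu hσ hK
  have h2 : IsLocalMinOn (fun s => u (σ s)) (Icc 0 1) 1 :=
    eventually_nhdsWithin_of_forall fun s hs => hmin _ (hK hs)
  have h3 : (-1 : ℝ) ∈ posTangentConeAt (Icc (0 : ℝ) 1) 1 := by
    refine mem_posTangentConeAt_of_segment_subset ?_
    rw [show (1 : ℝ) + -1 = 0 by norm_num, segment_symm, segment_eq_Icc zero_le_one]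
  have h4 := h2.hasFDerivWithinAt_nonneg h1.hasFDerivWithinAt h3
  simp at h4
  exact h4

theorem inner_eq_zero_of_curve_interior {K : Set Plane} {u : Plane → ℝ} {q t : Plane}
    {σ : ℝ → Plane} {s : ℝ} (hs : s ∈ Ioo (0 : ℝ) 1) (hu : HasGradientWithinAt u q K (σ s))
    (hσ : HasDerivWithinAt σ t (Icc 0 1) s) (hK : MapsTo σ (Icc 0 1) K)
    (hmin : ∀ x ∈ K, u (σ s) ≤ u x) : inner ℝ q t = 0 := by
  have hn : Icc (0 : ℝ) 1 ∈ 𝓝 s := Icc_mem_nhds hs.1 hs.2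
  have h1 := (hasDerivWithinAt_comp_curve hu hσ hK).hasDerivAt hn
  refine IsLocalMin.hasDerivAt_eq_zero ?_ h1
  filter_upwards [hn] with x hx using hmin _ (hK hx)

/-! ### Affine comparison functions -/

/-- The affine potential with velocity `w` and value `k` in the point `ξ`. -/
noncomputable def ConstState.through (k : ℝ) (w ξ : Plane) : ConstState := ⟨k - inner ℝ w ξ, w⟩

theorem ConstState.through_potential (k : ℝ) (w ξ x : Plane) :
    (ConstState.through k w ξ).potential x = k + inner ℝ w (x - ξ) := by
  simp only [ConstState.through, ConstState.potential, inner_sub_right]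
  ring

theorem HasGradientWithinAt.sub_potential {K : Set Plane} {ψ : Plane → ℝ} {w ξ : Plane}
    (h : HasGradientWithinAt ψ w K ξ) (ℓ : ConstState) (η : ℝ) :
    HasGradientWithinAt (fun x => η * (ψ x - ℓ.potential x)) (η • (w - ℓ.v)) K ξ := by
  have h1 := (ℓ.hasGradientAt_potential ξ).hasFDerivAt.hasFDerivWithinAt (s := K)
  have h2 := (h.hasFDerivWithinAt.sub h1).const_mul η
  rw [hasGradientWithinAt_iff_hasFDerivWithinAt]
  refine h2.congr_fderiv ?_
  simp

/-- The tangential velocities agree and cancel in Bernoulli's law. This reduces the shock relations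
to the one-dimensional ones for the normal velocities. -/
theorem enthalpyAt_of_jump {U : ConstState} {w ξ m : Plane} {l : ℝ} (hm : ‖m‖ = 1)
    (hw : U.v - w = l • m) :
    enthalpyAt (U.potential ξ) w ξ = -U.k - ‖U.v‖ ^ 2 / 2
      + (inner ℝ (U.v - ξ) m ^ 2 - inner ℝ (w - ξ) m ^ 2) / 2 := by
  have hw' : w - ξ = (U.v - ξ) - l • m := by rw [← hw]; abel
  rw [← U.enthalpyAt_eq ξ]
  unfold enthalpyAt
  rw [hw', norm_sub_sq_real, inner_sub_left (U.v - ξ) (l • m) m, inner_smul_left, inner_smul_right, norm_smul,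
    real_inner_self_eq_norm_sq, mul_pow, hm, Real.norm_eq_abs, sq_abs, conj_trivial]
  ring

theorem shockFun_of_jump {γ : ℝ} {U : ConstState} {w ξ m : Plane} {l : ℝ} (hm : ‖m‖ = 1)
    (hl : 0 < l) (hw : U.v - w = l • m) :
    shockFun γ U w ξ = density γ (-U.k - ‖U.v‖ ^ 2 / 2
      + (inner ℝ (U.v - ξ) m ^ 2 - inner ℝ (w - ξ) m ^ 2) / 2) * inner ℝ (w - ξ) m
      - density γ (-U.k - ‖U.v‖ ^ 2 / 2) * inner ℝ (U.v - ξ) m := by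
  unfold shockFun flowDensity ConstState.rho
  rw [enthalpyAt_of_jump hm hw, hw, norm_smul, hm, Real.norm_eq_abs, abs_of_pos hl, mul_one,
    smul_smul, inv_mul_cancel₀ hl.ne', one_smul, inner_sub_left, inner_smul_left, inner_smul_left]
  simp only [conj_trivial]

/-! ### Comparison on the elliptic region: shock, perturbed velocity and boundary minima -/

namespace IsTransonicPatch

variable {γ : ℝ} {U : ConstState} {E D AE : Set Plane} {ψ : Plane → ℝ} {v : Plane → Plane}
  {σ n : ℝ → Plane} {nA : Plane}

theorem hasDerivWithinAt (P : IsTransonicPatch γ U E D ψ v σ n AE nA) {s : ℝ}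
    (hs : s ∈ Icc (0 : ℝ) 1) :
    HasDerivWithinAt σ (derivWithin σ (Icc 0 1) s) (Icc 0 1) s :=
  ((P.shock_c1.differentiableOn one_ne_zero) s hs).hasDerivWithinAt

/-- The jump of the velocity is normal to the shock. -/
theorem jump_eq (P : IsTransonicPatch γ U E D ψ v σ n AE nA)
    (hσ : MapsTo σ (Icc 0 1) (closure E)) {s : ℝ} (hs : s ∈ Icc (0 : ℝ) 1) :
    ∃ l : ℝ, 0 < l ∧ U.v - v (σ s) = l • n s := by
  have hd := P.hasDerivWithinAt hs
  have h1 := hasDerivWithinAt_comp_curve (P.c1.1 _ (hσ hs)) hd hσ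
  have h2 := hasDerivWithinAt_comp_curve
    ((U.hasGradientAt_potential (σ s)).hasFDerivAt.hasFDerivWithinAt (s := closure E)) hd hσ
  have h3 : HasDerivWithinAt (fun s => ψ (σ s)) (inner ℝ U.v (derivWithin σ (Icc 0 1) s))
      (Icc 0 1) s :=
    h2.congr (fun x hx => (P.shock x hx).potential_eq.symm) (P.shock s hs).potential_eq.symm
  -- Both potentials agree along the curve, so the tangential derivatives agree, also one-sidedly at
  -- the endpoints.
  have h4 := (uniqueDiffOn_Icc (zero_lt_one' ℝ) s hs).eq_deriv _ h3 h1
  have h5 : inner ℝ (U.v - v (σ s)) (derivWithin σ (Icc 0 1) s) = 0 := by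
    rw [inner_sub_left, h4, sub_self]
  refine ⟨_, ?_, eq_smul_of_perp (P.shock s hs).norm_normal (P.shock_regular s hs)
    (P.normal_perp s hs) h5⟩
  have h6 := (P.shock s hs).admissible
  have h7 : U.v - v (σ s) = (U.v - σ s) - (v (σ s) - σ s) := by abel
  rw [h7, inner_sub_left]
  linarith

/-- There is no minimum in the interior of the shock. -/
theorem not_min_on_shock (hγ : 1 ≤ γ) (P : IsTransonicPatch γ U E D ψ v σ n AE nA)
    (hσ : MapsTo σ (Icc 0 1) (closure E)) {η : ℝ} (hη : η = 1 ∨ η = -1) {w : Plane}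
    (hg : 0 < η * shockFun γ U w (σ 0)) (hw : U.v - w ≠ 0)
    (hx : 0 < inner ℝ (U.v - w) (w - σ 0)) {s : ℝ} (hs : s ∈ Ioo (0 : ℝ) 1)
    (hcone : η = -1 → inner ℝ (U.v - w) (σ s - U.v) ≤ 0) :
    ¬ ∀ x ∈ closure E,
      η * (ψ (σ s) - (ConstState.through (ψ (σ 0)) w (σ 0)).potential (σ s))
        ≤ η * (ψ x - (ConstState.through (ψ (σ 0)) w (σ 0)).potential x) := by
  intro hmin
  set ℓ := ConstState.through (ψ (σ 0)) w (σ 0) with hℓ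
  have hsI : s ∈ Icc (0 : ℝ) 1 := Ioo_subset_Icc_self hs
  have hu := (P.c1.1 _ (hσ hsI)).sub_potential ℓ η
  have hm := (P.shock s hsI).norm_normal
  obtain ⟨l₁, hl₁, hj⟩ := P.jump_eq hσ hsI
  have ht := inner_eq_zero_of_curve_interior hs hu (P.hasDerivWithinAt hsI) hσ hmin
  have hη0 : η ≠ 0 := by rcases hη with rfl | rfl <;> norm_num
  have hℓv : ℓ.v = w := rfl
  rw [inner_smul_left, conj_trivial, hℓv] at ht
  -- The tangential derivative vanishes at the minimum, so `v - w` is normal here, like the jump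
  -- `U.v - v`. Hence `U.v - w` is normal as well.
  have hμ := eq_smul_of_perp hm (P.shock_regular s hsI) (P.normal_perp s hsI)
    ((mul_eq_zero.1 ht).resolve_left hη0)
  set μ := inner ℝ (v (σ s) - w) (n s) with hμdef
  have hμ0 : 0 ≤ η * μ := by
    have := inner_nonneg_of_min hu hmin (d := n s) (by
      filter_upwards [P.normal_side s hs] with t ht using subset_closure ht.1)
    rwa [inner_smul_left, conj_trivial, hℓv] at this
  have hN : U.v - w = (l₁ + μ) • n s := by
    rw [add_smul, ← hj, ← hμ]; abel
  have hq := P.shock s hsI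
  set l := l₁ + μ with hl
  -- For `η = -1` the change `μ` is nonpositive and might reverse the jump. The cone condition rules
  -- this out, because the upstream flow crosses the shock along `n s`.
  have hl0 : 0 < l := by
    rcases hη with h | h
    · rw [h] at hμ0; linarith
    · have hne : l ≠ 0 := by
        rintro h0
        rw [h0, zero_smul] at hN
        exact hw hN
      refine lt_of_le_of_ne (le_of_not_gt fun hneg => ?_) hne.symm
      have h1 := hcone h
      have h2 := hq.downstream.trans hq.admissible
      rw [hN, inner_smul_left, conj_trivial, ← neg_sub U.v, inner_neg_right,
        real_inner_comm] at h1
      nlinarith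
  have hpot0 := (P.shock 0 (left_mem_Icc.2 zero_le_one)).potential_eq
  -- On the shock `ψ` is the upstream potential, so `ψ - ℓ` equals `(U.v - w) · (σ s - σ 0)` there.
  -- Comparison with its value `0` at `σ 0` gives the sign of the displacement along the normal.
  have hval : η * (l * inner ℝ (n s) (σ s - σ 0)) ≤ 0 := by
    have h1 := hmin (σ 0) (hσ (left_mem_Icc.2 zero_le_one))
    rw [← hq.potential_eq, hℓ, ConstState.through_potential, ConstState.through_potential,
      ← hpot0, sub_self, inner_zero_right, add_zero, sub_self, mul_zero] at h1
    have h2 : U.potential (σ s) - (U.potential (σ 0) + inner ℝ w (σ s - σ 0))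
        = l * inner ℝ (n s) (σ s - σ 0) := by
      have h3 : inner ℝ (U.v - w) (σ s - σ 0) = l * inner ℝ (n s) (σ s - σ 0) := by
        rw [hN, inner_smul_left, conj_trivial]
      rw [← h3]
      simp only [ConstState.potential, inner_sub_left, inner_sub_right]
      ring
    rwa [h2] at h1
  set h := inner ℝ (n s) (σ s - σ 0) with hh
  have hηh : 0 ≤ η * -h := by
    have : l * (η * h) ≤ 0 := by linarith
    have := nonpos_of_mul_nonpos_right this hl0
    linarith
  have ey : inner ℝ (U.v - σ s) (n s) = inner ℝ (U.v - σ 0) (n s) + -h := by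
    rw [hh, real_inner_comm (σ s - σ 0), ← sub_eq_add_neg, ← inner_sub_left]; congr 1; abel
  have ex : inner ℝ (v (σ s) - σ s) (n s) = inner ℝ (w - σ 0) (n s) + -h + μ := by
    rw [hh, real_inner_comm (σ s - σ 0), hμdef, ← sub_eq_add_neg, ← inner_sub_left, ← inner_add_left]
    congr 1; abel
  have hlxy : inner ℝ (U.v - σ 0) (n s) - inner ℝ (w - σ 0) (n s) = l := by
    rw [← inner_sub_left, sub_sub_sub_cancel_right, hN, inner_smul_left,
      real_inner_self_eq_norm_sq, hm]
    simp
  have hmass := hq.mass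
  rw [U.flowDensity_eq, ← hq.potential_eq] at hmass
  unfold flowDensity ConstState.rho at hmass
  rw [enthalpyAt_of_jump hm hj, ey, ex] at hmass
  refine massBalance_contradiction hγ P.upstream_density hη hηh hμ0
    (x := inner ℝ (w - σ 0) (n s)) (y := inner ℝ (U.v - σ 0) (n s)) (by linarith) (fun _ => ?_)
    ?_ ?_ ?_ hmass
  · rw [hN, inner_smul_left, conj_trivial, real_inner_comm] at hx
    exact (mul_pos_iff_of_pos_left hl0).1 hx
  · rw [← ex]; exact hq.downstream
  · rw [← ex, ← ey]; exact hq.admissible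
  · rwa [← shockFun_of_jump hm hl0 hN]

/-- If the shock is strong-type in the reflection point, then the mass balance
has a sign after a perturbation of the downstream velocity in a direction close to that of the
pseudo-velocity. -/
theorem exists_perturbation (P : IsTransonicPatch γ U E D ψ v σ n AE nA)
    (hσ : MapsTo σ (Icc 0 1) (closure E)) (hnA : ‖nA‖ = 1) {a : Plane} (ha : inner ℝ nA a = 0)
    (hslip : inner ℝ (v (σ 0) - σ 0) nA = 0) (hst : IsStrongTypeAt γ U (v (σ 0)) (σ 0)) :
    ∃ e : Plane, inner ℝ e nA < 0 ∧ inner ℝ e a = inner ℝ (v (σ 0) - σ 0) a ∧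
      ∀ η : ℝ, η = 1 ∨ η = -1 → ∀ᶠ ε in 𝓝[>] (0 : ℝ),
        0 < η * shockFun γ U (v (σ 0) + (η * ε) • e) (σ 0) := by
  set z := v (σ 0) - σ 0 with hz
  set f := fun w => shockFun γ U w (σ 0) with hf
  have hst : 0 < inner ℝ (gradient f (v (σ 0))) z := hst
  have h0I : (0 : ℝ) ∈ Icc (0 : ℝ) 1 := left_mem_Icc.2 zero_le_one
  -- The gradient of a non-differentiable function is `0` by convention, so the strong-type
  -- inequality already contains differentiability.
  have hdiff : DifferentiableAt ℝ f (v (σ 0)) := by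
    by_contra h
    rw [gradient_eq_zero_of_not_differentiableAt h, inner_zero_left] at hst
    exact lt_irrefl _ hst
  -- The pseudo-velocity is tangential to the wall; a small tilt gives a strict sign in the normal
  -- direction without losing the strong-type inequality.
  obtain ⟨δ, hδ, hδ0⟩ : ∃ δ : ℝ, 0 < inner ℝ (gradient f (v (σ 0))) (z - δ • nA) ∧ 0 < δ := by
    have hc : Continuous fun δ : ℝ => inner ℝ (gradient f (v (σ 0))) (z - δ • nA) := by fun_prop
    have h1 := hc.tendsto 0
    simp only [zero_smul, sub_zero] at h1
    exact (((h1.mono_left nhdsWithin_le_nhds).eventually (lt_mem_nhds hst)).and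
      (self_mem_nhdsWithin (s := Ioi 0))).exists
  refine ⟨z - δ • nA, ?_, ?_, fun η hη => ?_⟩
  · rw [inner_sub_left, hslip, inner_smul_left, real_inner_self_eq_norm_sq, hnA]
    simpa using hδ0
  · rw [inner_sub_left, inner_smul_left, ha]; simp
  · set e := z - δ • nA
    obtain ⟨l, hl, hj⟩ := P.jump_eq hσ h0I
    have hm := (P.shock 0 h0I).norm_normal
    have hf0 : f (v (σ 0)) = 0 := by
      have hmass := (P.shock 0 h0I).mass
      rw [U.flowDensity_eq, ← (P.shock 0 h0I).potential_eq] at hmass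
      unfold flowDensity ConstState.rho at hmass
      rw [enthalpyAt_of_jump hm hj] at hmass
      simp only [hf]
      rw [shockFun_of_jump hm hl hj, hmass, sub_self]
    have hline : HasDerivAt (fun ε : ℝ => v (σ 0) + (η * ε) • e) (η • e) 0 := by
      have h1 : HasDerivAt (fun ε : ℝ => η * ε) η 0 := by
        simpa using (hasDerivAt_id (0 : ℝ)).const_mul η
      exact (h1.smul_const e).const_add _
    have hgr := hdiff.hasGradientAt.hasFDerivAt
    have hcomp : HasDerivAt (fun ε : ℝ => f (v (σ 0) + (η * ε) • e))
        (inner ℝ (gradient f (v (σ 0))) (η • e)) 0 := by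
      have h2 : HasFDerivAt f (InnerProductSpace.toDual ℝ Plane (gradient f (v (σ 0))))
          (v (σ 0) + (η * 0) • e) := by simpa using hgr
      have h3 := h2.comp_hasDerivAt (0 : ℝ) hline
      rw [InnerProductSpace.toDual_apply_apply] at h3
      exact h3
    have hd := hcomp.const_mul η
    have hηη : η * η = 1 := by rcases hη with rfl | rfl <;> norm_num
    rw [inner_smul_right, ← mul_assoc, hηη, one_mul, hasDerivAt_iff_tendsto_slope] at hd
    have hd' := hd.mono_left (nhdsWithin_mono (0 : ℝ)
      (show Ioi (0 : ℝ) ⊆ {0}ᶜ from fun x hx => ne_of_gt hx))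
    filter_upwards [hd'.eventually (lt_mem_nhds hδ), self_mem_nhdsWithin] with ε h1 h2
    have h2 : 0 < ε := h2
    rw [slope_def_field] at h1
    simp only [mul_zero, zero_smul, add_zero, hf0, sub_zero] at h1
    exact (div_pos_iff_of_pos_right h2).1 h1

/-- The difference between the potential and an affine function attains its minimum on
the boundary. -/
theorem exists_frontier_min (hγ : 1 ≤ γ) (P : IsTransonicPatch γ U E D ψ v σ n AE nA)
    (hfr : (frontier E).Nonempty) (ℓ : ConstState) {η : ℝ} (hη : η = 1 ∨ η = -1) :
    ∃ ξ₀ ∈ frontier E, ∀ x ∈ closure E,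
      η * (ψ ξ₀ - ℓ.potential ξ₀) ≤ η * (ψ x - ℓ.potential x) := by
  have hc : ContinuousOn (fun x => η * (ψ x - ℓ.potential x)) (frontier E) := fun ξ hξ =>
    (((P.c1.1 ξ (frontier_subset_closure hξ)).sub_potential ℓ
      η).hasFDerivWithinAt.continuousWithinAt).mono frontier_subset_closure
  have hK : IsCompact (frontier E) :=
    P.isBounded.isCompact_closure.of_isClosed_subset isClosed_frontier frontier_subset_closure
  obtain ⟨ξ₀, hξ₀, hmin⟩ := hK.exists_isMinOn hfr hc
  exact ⟨ξ₀, hξ₀, weak_maximum_principle hγ P.isOpen P.isBounded P.c1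
    (fun ξ hξ => P.density_pos ξ (subset_closure hξ)) P.weakSolution P.elliptic ℓ hη
    fun ξ hξ => hmin hξ⟩

theorem inner_nonneg_of_min (P : IsTransonicPatch γ U E D ψ v σ n AE nA) {ℓ : ConstState} {η : ℝ}
    {ξ d : Plane} (hξ : ξ ∈ closure E)
    (hmin : ∀ x ∈ closure E, η * (ψ ξ - ℓ.potential ξ) ≤ η * (ψ x - ℓ.potential x))
    (hd : ∀ᶠ t in 𝓝[>] (0 : ℝ), ξ + t • d ∈ closure E) : 0 ≤ η * inner ℝ (v ξ - ℓ.v) d := by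
  have := _root_.inner_nonneg_of_min ((P.c1.1 ξ hξ).sub_potential ℓ η) hmin hd
  rwa [inner_smul_left, conj_trivial] at this

theorem inner_nonpos_of_min_end (P : IsTransonicPatch γ U E D ψ v σ n AE nA)
    (hσ : MapsTo σ (Icc 0 1) (closure E)) {ℓ : ConstState} {η : ℝ}
    (hmin : ∀ x ∈ closure E, η * (ψ (σ 1) - ℓ.potential (σ 1)) ≤ η * (ψ x - ℓ.potential x)) :
    η * inner ℝ (v (σ 1) - ℓ.v) (derivWithin σ (Icc 0 1) 1) ≤ 0 := by
  have h1 : (1 : ℝ) ∈ Icc (0 : ℝ) 1 := right_mem_Icc.2 zero_le_one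
  have := inner_nonpos_of_curve_end ((P.c1.1 _ (hσ h1)).sub_potential ℓ η)
    (P.hasDerivWithinAt h1) hσ hmin
  rwa [inner_smul_left, conj_trivial] at this

/-- A slip condition on an open segment extends to its endpoints. -/
theorem slip_segment (P : IsTransonicPatch γ U E D ψ v σ n AE nA) {x y m : Plane}
    (hK : segment ℝ x y ⊆ closure E) (h : ∀ ξ ∈ openSegment ℝ x y, IsSlip (v ξ) ξ m) :
    ∀ ξ ∈ segment ℝ x y, inner ℝ (v ξ - ξ) m = 0 := by
  have hc : ContinuousOn (fun ξ => inner ℝ (v ξ - ξ) m) (segment ℝ x y) :=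
    ((P.c1.2.mono hK).sub continuousOn_id).inner continuousOn_const
  have h' : EqOn (fun ξ => inner ℝ (v ξ - ξ) m) (fun _ => 0) (openSegment ℝ x y) := h
  exact h'.of_subset_closure hc continuousOn_const (openSegment_subset_segment ℝ x y)
    segment_subset_closure_openSegment

end IsTransonicPatch

/-! ### Straight walls and the beginning of the shock curve -/

theorem exists_of_mem_segment {c a ξ : Plane} {l : ℝ} (hl : 0 < l)
    (h : ξ ∈ segment ℝ c (c + l • a)) : ∃ x : ℝ, 0 ≤ x ∧ x ≤ l ∧ ξ = c + x • a := by
  rw [segment_eq_image'] at h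
  obtain ⟨t, ht, rfl⟩ := h
  refine ⟨t * l, mul_nonneg ht.1 hl.le, by nlinarith [ht.2], ?_⟩
  simp [smul_smul]

theorem mem_openSegment_iff_exists {c a ξ : Plane} {l : ℝ} (hl : 0 < l) :
    ξ ∈ openSegment ℝ c (c + l • a) ↔ ∃ x : ℝ, 0 < x ∧ x < l ∧ ξ = c + x • a := by
  rw [openSegment_eq_image']
  constructor
  · rintro ⟨t, ht, rfl⟩
    exact ⟨t * l, mul_pos ht.1 hl, by nlinarith [ht.2], by simp [smul_smul]⟩
  · rintro ⟨x, hx0, hxl, rfl⟩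
    refine ⟨x / l, ⟨by positivity, by rwa [div_lt_one hl]⟩, ?_⟩
    simp only [add_sub_cancel_left, smul_smul]
    rw [div_mul_cancel₀ _ hl.ne']

/-- Near a point of a straight wall segment, away from the remaining boundary, the inner normal
points into the domain. -/
theorem eventually_mem_of_frontier_subset {E F : Set Plane} {m c d x₀ : Plane} (hm : ‖m‖ = 1)
    (hE : IsOpen E) (hside : ∀ x ∈ E, inner ℝ m (x - c) < 0) (hx₀ : x₀ ∈ closure E)
    (hF : IsClosed F) (hxF : x₀ ∉ F) (hfr : frontier E ⊆ F ∪ segment ℝ c d)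
    (hd : inner ℝ m (d - c) = 0) (hx₀s : x₀ ∈ segment ℝ c d) :
    ∀ᶠ t in 𝓝[>] (0 : ℝ), x₀ + t • (-m) ∈ closure E := by
  have hseg : ∀ x ∈ segment ℝ c d, inner ℝ m (x - c) = 0 := by
    intro x hx
    rw [segment_eq_image'] at hx
    obtain ⟨t, -, rfl⟩ := hx
    simp only [add_sub_cancel_left]
    rw [inner_smul_right, hd, mul_zero]
  refine eventually_mem_of_wall_direction hm hE hside hx₀ (hseg x₀ hx₀s) ?_
  filter_upwards [hF.isOpen_compl.mem_nhds hxF] with x hx hxf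
  exact (hseg x ((hfr hxf).resolve_left hx)).ge

theorem hasDerivWithinAt_inner_curve {σ : ℝ → Plane} {t : Plane} {I : Set ℝ} {s : ℝ}
    (hd : HasDerivWithinAt σ t I s) (m c : Plane) :
    HasDerivWithinAt (fun s => inner ℝ m (σ s - c)) (inner ℝ m t) I s :=
  (innerSL ℝ m).hasFDerivAt.comp_hasDerivWithinAt s (hd.sub_const c)

/-- Near a corner with tangent direction `t`, a regular curve stays on one side of the lines
through the corner that are transversal to `t`. -/
theorem eventually_side_of_curve {σ : ℝ → Plane} {t m : Plane} (hc : ContinuousOn σ (Icc 0 1))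
    (hinj : InjOn σ (Icc 0 1)) (hd : HasDerivWithinAt σ t (Icc 0 1) 0) (hm : inner ℝ m t < 0) :
    ∀ᶠ x in 𝓝 (σ 0), ∀ s ∈ Icc (0 : ℝ) 1, σ s = x → s = 0 ∨ inner ℝ m (x - σ 0) < 0 := by
  have hd' := hasDerivWithinAt_inner_curve hd m (σ 0)
  rw [hasDerivWithinAt_iff_tendsto_slope] at hd'
  have h1 := hd'.eventually (gt_mem_nhds hm)
  rw [eventually_nhdsWithin_iff, Metric.eventually_nhds_iff_ball] at h1
  obtain ⟨r, hr, hball⟩ := h1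
  -- For small parameters the derivative at `0` decides the side; simplicity and compactness keep
  -- the rest of the curve away from `σ 0`.
  have hK : IsCompact (σ '' (Icc (min r 1) 1)) := by
    refine isCompact_Icc.image_of_continuousOn (hc.mono (Icc_subset_Icc_left ?_))
    exact le_min hr.le zero_le_one
  have hnot : σ 0 ∉ σ '' (Icc (min r 1) 1) := by
    rintro ⟨s, hs, hs0⟩
    have hpos : 0 < min r 1 := lt_min hr one_pos
    have := hinj ⟨hpos.le.trans hs.1, hs.2⟩ (left_mem_Icc.2 zero_le_one) hs0
    rw [this] at hs
    exact absurd hs.1 (not_le.2 hpos)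
  filter_upwards [hK.isClosed.isOpen_compl.mem_nhds hnot] with x hx s hs hsx
  by_cases hs0 : s = 0
  · exact Or.inl hs0
  · right
    have hs0' : 0 < s := lt_of_le_of_ne hs.1 (Ne.symm hs0)
    have hsr : s < r := by
      by_contra h
      exact hx ⟨s, ⟨(min_le_left _ _).trans (not_lt.1 h), hs.2⟩, hsx⟩
    have h2 := hball s (by simpa [abs_of_pos hs0'] using hsr) ⟨hs, hs0⟩
    rw [slope_def_field, sub_self, inner_zero_right, sub_zero, sub_zero, hsx] at h2
    exact (div_neg_iff.1 h2).elim (fun h => absurd h.2 hs0'.not_gt) (fun h => h.1)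

/-! ### Classical regular reflection -/

namespace ClassicalReflection

variable {γ : ℝ} (R : ClassicalReflection γ)

theorem segment_A_subset : segment ℝ R.corner R.refl ⊆ frontier R.E := by
  rw [R.frontier_E]
  exact fun x hx => Or.inl (Or.inr hx)

theorem segment_B_subset : segment ℝ R.corner R.foot ⊆ frontier R.E := by
  rw [R.frontier_E]
  exact fun x hx => Or.inr hx

theorem mapsTo_shock : MapsTo R.σ (Icc 0 1) (closure R.E) := fun s hs =>
  frontier_subset_closure (by rw [R.frontier_E]; exact Or.inl (Or.inl ⟨s, hs, rfl⟩))

theorem slip_A {ξ : Plane} (hξ : ξ ∈ segment ℝ R.corner R.refl) :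
    inner ℝ (R.v ξ - ξ) R.nA = 0 :=
  R.patch.slip_segment (R.segment_A_subset.trans frontier_subset_closure) R.patch.slip ξ hξ

theorem slip_foot {ξ : Plane} (hξ : ξ ∈ segment ℝ R.corner R.foot) :
    inner ℝ (R.v ξ - ξ) R.nB = 0 :=
  R.patch.slip_segment (R.segment_B_subset.trans frontier_subset_closure) R.slip_B ξ hξ

theorem inner_nA_corner {ξ : Plane} (hξ : ξ ∈ segment ℝ R.corner R.refl) :
    inner ℝ (ξ - R.corner) R.nA = 0 := by
  rw [R.refl_eq] at hξ
  obtain ⟨x, -, -, rfl⟩ := exists_of_mem_segment R.lenA_pos hξ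
  rw [add_sub_cancel_left, inner_smul_left, real_inner_comm, R.nA_perp, mul_zero]

theorem inner_nB_corner {ξ : Plane} (hξ : ξ ∈ segment ℝ R.corner R.foot) :
    inner ℝ (ξ - R.corner) R.nB = 0 := by
  rw [R.foot_eq] at hξ
  obtain ⟨x, -, -, rfl⟩ := exists_of_mem_segment R.lenB_pos hξ
  rw [add_sub_cancel_left, inner_smul_left, real_inner_comm, R.nB_perp, mul_zero]

/-- The velocity jump at the incident shock. -/
theorem incident_jump : ∃ l : ℝ, 0 < l ∧ R.U₁.v - R.U.v = l • R.nQ ∧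
    0 < inner ℝ (R.U.v - R.refl) R.nQ := by
  have h0 := R.incident_shock 0 le_rfl
  have h1 := R.incident_shock 1 zero_le_one
  rw [zero_smul, add_zero] at h0
  have e0 := h0.potential_eq
  have e1 := h1.potential_eq
  have hq : inner ℝ (R.U₁.v - R.U.v) R.q = 0 := by
    simp only [ConstState.potential, inner_add_right, one_smul, inner_sub_left] at e0 e1 ⊢
    linarith
  refine ⟨_, ?_, eq_smul_of_perp h0.norm_normal R.q_ne_zero R.nQ_perp hq, h0.downstream⟩
  have h2 := h0.admissible
  rw [← sub_pos, ← inner_sub_left, sub_sub_sub_cancel_right] at h2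
  exact h2

/-- As seen from the reflection point, the flow is directed towards the corner, and so is the
reflected shock normal. -/
theorem directions :
    inner ℝ (R.v R.refl - R.refl) R.a < 0 ∧ inner ℝ (R.n 0) R.a < 0 := by
  have h0I : (0 : ℝ) ∈ Icc (0 : ℝ) 1 := left_mem_Icc.2 zero_le_one
  obtain ⟨lQ, hlQ, hjQ, hdQ⟩ := R.incident_jump
  obtain ⟨l, hl, hj⟩ := R.patch.jump_eq R.mapsTo_shock h0I
  have hshock := R.patch.shock 0 h0I
  rw [R.shock_start] at hj hshock
  have hnQ := (R.incident_shock 0 le_rfl).norm_normal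
  have hU₁ : inner ℝ (R.U₁.v - R.refl) R.nA = 0 := by
    rw [R.refl_eq]; exact R.slip_U₁ R.lenA le_rfl
  have hz : inner ℝ (R.v R.refl - R.refl) R.nA = 0 := R.slip_A (right_mem_segment ℝ _ _)
  have hexp := plane_inner_eq R.norm_a R.norm_nA R.nA_perp
  set z₁ := R.U₁.v - R.refl
  set zI := R.U.v - R.refl
  set z := R.v R.refl - R.refl
  have e1 : inner ℝ z₁ R.nQ = inner ℝ z₁ R.a * inner ℝ R.nQ R.a := by
    rw [hexp, hU₁, zero_mul, add_zero]
  have e2 : inner ℝ z (R.n 0) = inner ℝ z R.a * inner ℝ (R.n 0) R.a := by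
    rw [hexp, hz, zero_mul, add_zero]
  have e3 : zI = z₁ - lQ • R.nQ := by rw [← hjQ]; simp only [zI, z₁]; abel
  have e4 : zI = z + l • R.n 0 := by rw [← hj]; simp only [zI, z]; abel
  have e5 : inner ℝ zI R.a = inner ℝ z₁ R.a - lQ * inner ℝ R.nQ R.a := by
    rw [e3, inner_sub_left, inner_smul_left, conj_trivial]
  have e6 : inner ℝ zI R.nQ = inner ℝ z₁ R.nQ - lQ := by
    rw [e3, inner_sub_left, inner_smul_left, conj_trivial, real_inner_self_eq_norm_sq, hnQ]
    ring
  have e7 : inner ℝ zI R.a = inner ℝ z R.a + l * inner ℝ (R.n 0) R.a := by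
    rw [e4, inner_add_left, inner_smul_left, conj_trivial]
  have e8 : inner ℝ R.nQ R.a ^ 2 ≤ 1 := by
    have := abs_real_inner_le_norm R.nQ R.a
    rw [hnQ, R.norm_a, mul_one] at this
    rw [← sq_abs]
    exact pow_le_one₀ (abs_nonneg _) this
  have hside := R.nQ_side
  have hdown := hshock.downstream
  rw [e2] at hdown
  rw [e6, e1] at hdQ
  -- Ahead of the incident shock the flow is parallel to `A`, so crossing that shock forces the
  -- direction towards the corner. The normal jump is too small to reverse it, which gives `hIa`.
  have hα : inner ℝ z₁ R.a < 0 := by nlinarith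
  have hIa : inner ℝ zI R.a < 0 := by nlinarith
  have hn : inner ℝ (R.n 0) R.a < 0 := by
    by_contra hn
    push Not at hn
    have : 0 < inner ℝ z R.a := by
      by_contra h
      nlinarith
    nlinarith
  exact ⟨by nlinarith, hn⟩

/-- If the upstream flow leaves the opposite wall, as seen from the downstream state at the
reflection point, then the reflected shock turns the flow away from the reflection wall. -/
theorem normal_side_A (hB : inner ℝ (R.n 0) R.nB < 0) : 0 < inner ℝ (R.n 0) R.nA := by
  have h0I : (0 : ℝ) ∈ Icc (0 : ℝ) 1 := left_mem_Icc.2 zero_le_one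
  obtain ⟨lQ, hlQ, hjQ, -⟩ := R.incident_jump
  obtain ⟨l, hl, hj⟩ := R.patch.jump_eq R.mapsTo_shock h0I
  have hperp := R.patch.normal_perp 0 h0I
  have htne := R.patch.shock_regular 0 h0I
  have hder := R.patch.hasDerivWithinAt h0I
  have hexp := plane_inner_eq R.norm_a R.norm_nA R.nA_perp
  rw [R.shock_start] at hj
  have hU₁ : inner ℝ (R.U₁.v - R.refl) R.nA = 0 := by
    rw [R.refl_eq]; exact R.slip_U₁ R.lenA le_rfl
  have hz : inner ℝ (R.v R.refl - R.refl) R.nA = 0 := R.slip_A (right_mem_segment ℝ _ _)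
  have hn := R.directions.2
  -- Otherwise the reflected shock would start on the `U₁` side of the incident shock, and points of
  -- the latter near `refl` would lie in `E`.
  by_contra hle
  push Not at hle
  have e1 : l * inner ℝ (R.n 0) R.nA = -(lQ * inner ℝ R.nQ R.nA) := by
    -- The flows before and after both shocks satisfy the slip condition on `A`, so the two jumps
    -- cancel in the direction `nA`.
    have h1 : l • R.n 0 + lQ • R.nQ = (R.U₁.v - R.refl) - (R.v R.refl - R.refl) := by
      rw [← hj, ← hjQ]; abel
    have h2 := congrArg (fun x => inner ℝ x R.nA) h1
    simp only [inner_add_left, inner_smul_left, conj_trivial] at h2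
    rw [inner_sub_left, hU₁, hz] at h2
    linarith
  have hnA : inner ℝ (R.n 0) R.nA < 0 := by
    refine lt_of_le_of_ne hle fun h0 => ?_
    rw [hexp, h0, zero_mul, add_zero] at hB
    nlinarith [R.nB_outer]
  have hω : 0 < inner ℝ R.nQ R.nA := by
    by_contra h
    nlinarith
  set t := derivWithin R.σ (Icc 0 1) 0 with ht
  have htA : inner ℝ R.nA t ≤ 0 := by
    have h1 := hasDerivWithinAt_inner_curve hder R.nA R.corner
    have hval : inner ℝ R.nA (R.σ 0 - R.corner) = 0 := by
      rw [R.shock_start, real_inner_comm]; exact R.inner_nA_corner (right_mem_segment ℝ _ _)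
    rw [hasDerivWithinAt_iff_tendsto_slope] at h1
    have h2 := h1.mono_left (nhdsWithin_mono (0 : ℝ) (show Ioo (0 : ℝ) 1 ⊆ Icc 0 1 \ {0} from
      fun s hs => ⟨Ioo_subset_Icc_self hs, hs.1.ne'⟩))
    have : (𝓝[Ioo (0 : ℝ) 1] 0).NeBot := left_nhdsWithin_Ioo_neBot one_pos
    refine le_of_tendsto h2 ?_
    filter_upwards [self_mem_nhdsWithin] with s hs
    rw [slope_def_field, hval, sub_zero, sub_zero]
    exact div_nonpos_of_nonpos_of_nonneg (R.shock_domain s hs).1.le hs.1.le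
  have hperp' : inner ℝ (R.n 0) R.a * inner ℝ t R.a + inner ℝ (R.n 0) R.nA * inner ℝ t R.nA = 0 := by
    rw [← hexp]; exact hperp
  rw [real_inner_comm] at htA
  have htA' : inner ℝ t R.nA < 0 := by
    refine lt_of_le_of_ne htA fun h0 => htne ?_
    rw [h0, mul_zero, add_zero] at hperp'
    refine eq_of_inner_eq R.norm_a R.norm_nA R.nA_perp ?_ (by rw [h0, inner_zero_left])
    rw [inner_zero_left]
    exact (mul_eq_zero.1 hperp').resolve_left hn.ne
  have hta : 0 < inner ℝ t R.a := by
    by_contra h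
    nlinarith
  have hQt : inner ℝ R.nQ t < 0 := by
    rw [hexp]
    nlinarith [R.nQ_side]
  have hev := eventually_side_of_curve R.patch.shock_c1.continuousOn R.patch.shock_inj hder hQt
  rw [R.shock_start] at hev
  have hreflB : R.refl ∉ segment ℝ R.corner R.foot := fun h => by
    have h1 := R.inner_nB_corner h
    rw [R.refl_eq, add_sub_cancel_left, inner_smul_left, conj_trivial, real_inner_comm] at h1
    nlinarith [R.nB_outer, R.lenA_pos]
  have hclB : IsClosed (segment ℝ R.corner R.foot) := by
    rw [← closure_openSegment]; exact isClosed_closure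
  obtain ⟨r, hr, hball⟩ := Metric.eventually_nhds_iff_ball.1
    (hev.and (hclB.isOpen_compl.mem_nhds hreflB))
  -- Near `refl`, the part of the flow domain on the far side of the incident shock line, line
  -- included. It meets no boundary of `E` and contains points of `E` close to the wall, so by
  -- convexity it lies in `E`.
  set C := (Metric.ball R.refl r ∩ {x | inner ℝ R.nA (x - R.corner) < 0}) ∩
    {x | 0 ≤ inner ℝ R.nQ (x - R.refl)} with hC
  have hconv : Convex ℝ C := by
    refine (convex_ball_inter_halfPlane _ _ _ _).inter ?_
    have : {x : Plane | 0 ≤ inner ℝ R.nQ (x - R.refl)}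
        = {x | inner ℝ R.nQ R.refl ≤ innerSL ℝ R.nQ x} := by
      ext x; simp [inner_sub_right]
    rw [this]
    exact convex_halfSpace_ge (innerSL ℝ R.nQ).isLinear _
  have hCE : C ⊆ R.E := by
    refine hconv.subset_of_disjoint_frontier R.patch.isOpen (fun x hx hxf => ?_) ?_
    · rw [R.frontier_E] at hxf
      rcases hxf with (⟨s, hs, hsx⟩ | hxA) | hxB
      · rcases (hball x hx.1.1).1 s hs hsx with h | h
        · have h1 := hx.1.2
          rw [mem_ofPred_eq, ← hsx, h, R.shock_start, real_inner_comm,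
            R.inner_nA_corner (right_mem_segment ℝ _ _)] at h1
          exact lt_irrefl _ h1
        · exact absurd hx.2 (not_le.2 h)
      · have h1 := hx.1.2
        rw [mem_ofPred_eq, real_inner_comm, R.inner_nA_corner hxA] at h1
        exact lt_irrefl _ h1
      · exact (hball x hx.1.1).2 hxB
    · -- a point of the domain near the wall
      obtain ⟨x, hx0, hxr⟩ := exists_between (lt_min hr R.lenA_pos)
      set y := R.refl + x • (-R.a) with hy
      have hyS : y ∈ segment ℝ R.corner R.refl := by
        rw [R.refl_eq]
        refine openSegment_subset_segment _ _ _ ((mem_openSegment_iff_exists R.lenA_pos).2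
          ⟨R.lenA - x, by linarith [min_le_right r R.lenA], by linarith, ?_⟩)
        rw [hy, R.refl_eq]; module
      have hyc := frontier_subset_closure (R.segment_A_subset hyS)
      have hopen : IsOpen (Metric.ball R.refl r ∩ {x | 0 < inner ℝ R.nQ (x - R.refl)}) := by
        refine Metric.isOpen_ball.inter (isOpen_lt continuous_const ?_)
        fun_prop
      obtain ⟨p, hp, hpE⟩ := mem_closure_iff.1 hyc _ hopen ⟨by
          rw [Metric.mem_ball, hy, dist_eq_norm, add_sub_cancel_left, norm_smul, norm_neg, R.norm_a,
            mul_one, Real.norm_eq_abs, abs_of_pos hx0]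
          exact hxr.trans_le (min_le_left _ _), by
          rw [mem_ofPred_eq, hy, add_sub_cancel_left, inner_smul_right, inner_neg_right]
          nlinarith [R.nQ_side]⟩
      exact ⟨p, ⟨⟨hp.1, (R.E_domain p hpE).1⟩, (show 0 ≤ inner ℝ R.nQ (p - R.refl) from le_of_lt hp.2)⟩, hpE⟩
  obtain ⟨τ, hτb, hτ⟩ := (((tendsto_add_smul R.refl R.q).eventually
    (Metric.ball_mem_nhds R.refl hr)).and (self_mem_nhdsWithin (s := Ioi (0 : ℝ)))).exists
  refine R.incident_disjoint τ hτ (subset_closure (hCE ⟨⟨hτb, (R.incident_domain τ hτ).1⟩, ?_⟩))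
  rw [mem_ofPred_eq, add_sub_cancel_left, inner_smul_right, R.nQ_perp, mul_zero]

theorem sigma_mem_segment_A {s : ℝ} (hs : s ∈ Icc (0 : ℝ) 1)
    (h : R.σ s ∈ openSegment ℝ R.corner R.refl) : False := by
  have h1 := R.inner_nA_corner (openSegment_subset_segment _ _ _ h)
  rw [real_inner_comm] at h1
  rcases eq_endpoints_or_mem_Ioo_of_mem_Icc hs with rfl | rfl | hs'
  · rw [R.shock_start, R.refl_eq, mem_openSegment_iff_exists R.lenA_pos] at h
    obtain ⟨x, -, hx, he⟩ := h
    have h2 := congrArg (fun y => inner ℝ y R.a) (add_left_cancel he)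
    simp only [inner_smul_left, real_inner_self_eq_norm_sq, R.norm_a, conj_trivial] at h2
    linarith
  · rw [R.shock_end, R.foot_eq, add_sub_cancel_left, inner_smul_right] at h1
    nlinarith [R.nA_outer, R.lenB_pos]
  · exact absurd h1 (R.shock_domain s hs').1.ne

theorem sigma_mem_segment_B {s : ℝ} (hs : s ∈ Icc (0 : ℝ) 1)
    (h : R.σ s ∈ openSegment ℝ R.corner R.foot) : False := by
  have h1 := R.inner_nB_corner (openSegment_subset_segment _ _ _ h)
  rw [real_inner_comm] at h1
  rcases eq_endpoints_or_mem_Ioo_of_mem_Icc hs with rfl | rfl | hs'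
  · rw [R.shock_start, R.refl_eq, add_sub_cancel_left, inner_smul_right] at h1
    nlinarith [R.nB_outer, R.lenA_pos]
  · rw [R.shock_end, R.foot_eq, mem_openSegment_iff_exists R.lenB_pos] at h
    obtain ⟨x, -, hx, he⟩ := h
    have h2 := congrArg (fun y => inner ℝ y R.b) (add_left_cancel he)
    simp only [inner_smul_left, real_inner_self_eq_norm_sq, R.norm_b, conj_trivial] at h2
    linarith
  · exact absurd h1 (R.shock_domain s hs').2.ne

theorem isClosed_shock : IsClosed (R.σ '' Icc 0 1) :=
  (isCompact_Icc.image_of_continuousOn R.patch.shock_c1.continuousOn).isClosed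

theorem eventually_mem_A {ξ : Plane} (hξ : ξ ∈ openSegment ℝ R.corner R.refl) :
    ∀ᶠ t in 𝓝[>] (0 : ℝ), ξ + t • (-R.nA) ∈ closure R.E := by
  have hcl : IsClosed (segment ℝ R.corner R.foot) := by
    rw [← closure_openSegment]; exact isClosed_closure
  have hseg := openSegment_subset_segment ℝ _ _ hξ
  refine eventually_mem_of_frontier_subset (F := R.σ '' Icc 0 1 ∪ segment ℝ R.corner R.foot)
    (c := R.corner) (d := R.refl) R.norm_nA R.patch.isOpen (fun x hx => (R.E_domain x hx).1)
    (frontier_subset_closure (R.segment_A_subset hseg)) (R.isClosed_shock.union hcl) ?_ ?_ ?_ hseg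
  · rintro (⟨s, hs, rfl⟩ | h)
    · exact R.sigma_mem_segment_A hs hξ
    · have h1 := R.inner_nB_corner h
      rw [R.refl_eq, mem_openSegment_iff_exists R.lenA_pos] at hξ
      obtain ⟨x, hx0, -, rfl⟩ := hξ
      rw [add_sub_cancel_left, inner_smul_left, conj_trivial, real_inner_comm] at h1
      nlinarith [R.nB_outer]
  · rw [R.frontier_E]
    rintro x ((h | h) | h)
    exacts [Or.inl (Or.inl h), Or.inr h, Or.inl (Or.inr h)]
  · rw [real_inner_comm]; exact R.inner_nA_corner (right_mem_segment ℝ _ _)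

theorem eventually_mem_B {ξ : Plane} (hξ : ξ ∈ openSegment ℝ R.corner R.foot) :
    ∀ᶠ t in 𝓝[>] (0 : ℝ), ξ + t • (-R.nB) ∈ closure R.E := by
  have hcl : IsClosed (segment ℝ R.corner R.refl) := by
    rw [← closure_openSegment]; exact isClosed_closure
  have hseg := openSegment_subset_segment ℝ _ _ hξ
  refine eventually_mem_of_frontier_subset (F := R.σ '' Icc 0 1 ∪ segment ℝ R.corner R.refl)
    (c := R.corner) (d := R.foot) R.norm_nB R.patch.isOpen (fun x hx => (R.E_domain x hx).2)
    (frontier_subset_closure (R.segment_B_subset hseg)) (R.isClosed_shock.union hcl) ?_ ?_ ?_ hseg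
  · rintro (⟨s, hs, rfl⟩ | h)
    · exact R.sigma_mem_segment_B hs hξ
    · have h1 := R.inner_nA_corner h
      rw [R.foot_eq, mem_openSegment_iff_exists R.lenB_pos] at hξ
      obtain ⟨x, hx0, -, rfl⟩ := hξ
      rw [add_sub_cancel_left, inner_smul_left, conj_trivial, real_inner_comm] at h1
      nlinarith [R.nA_outer]
  · exact R.frontier_E.subset
  · rw [real_inner_comm]; exact R.inner_nB_corner (right_mem_segment ℝ _ _)

/-- If the upstream flow leaves the opposite wall, then its velocity, as seen from the downstream
state at the reflection point, is directed out of the corner along neither wall. -/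
theorem normal_side_b (hB : inner ℝ (R.n 0) R.nB < 0) : inner ℝ (R.n 0) R.b < 0 := by
  have hexp := plane_inner_eq R.norm_a R.norm_nA R.nA_perp
  have h1 := R.normal_side_A hB
  have h2 := R.directions.2
  have h3 := R.nB_outer
  have h4 := R.nA_outer
  have h5 := R.nB_perp
  rw [hexp] at hB h5 ⊢
  rw [real_inner_comm] at h4
  -- The three signs force the corner to be acute, `h7`, and then both components of `n 0`
  -- contribute negatively along `b`.
  have h6 : inner ℝ R.nB R.nA < 0 := by
    by_contra h
    nlinarith
  have h7 : 0 < inner ℝ R.b R.a := by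
    by_contra h
    nlinarith
  nlinarith

/-- There is no minimum on the walls, the reflected shock and in the corners, for affine comparison
functions with suitable velocities `w`. -/
theorem not_min (hγ : 1 ≤ γ) {η : ℝ} (hη : η = 1 ∨ η = -1) {w : Plane}
    (hg : 0 < η * shockFun γ R.U w R.refl)
    (hx : 0 < inner ℝ (R.U.v - w) (w - R.refl))
    (hwa : η * inner ℝ (R.v R.refl - w) (-R.a) < 0)
    (hwA : 0 < η * inner ℝ (R.v R.refl - w) R.nA) (hwB : 0 < η * inner ℝ (R.U.v - w) R.nB)
    (hcone : η = -1 → inner ℝ (R.U.v - w) R.a < 0 ∧ inner ℝ (R.U.v - w) R.b < 0 ∧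
      0 < inner ℝ (R.n 0) R.nA) : False := by
  have h0I : (0 : ℝ) ∈ Icc (0 : ℝ) 1 := left_mem_Icc.2 zero_le_one
  have h1I : (1 : ℝ) ∈ Icc (0 : ℝ) 1 := right_mem_Icc.2 zero_le_one
  have P := R.patch
  have hσ := R.mapsTo_shock
  have hreflA : R.refl ∈ segment ℝ R.corner R.refl := right_mem_segment ℝ _ _
  have hfootB : R.foot ∈ segment ℝ R.corner R.foot := right_mem_segment ℝ _ _
  have hKA := R.segment_A_subset.trans frontier_subset_closure
  have hKB := R.segment_B_subset.trans frontier_subset_closure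
  -- Slip along a straight wall fixes the normal velocity to `corner · nB`, for `ψ` and for the
  -- state `U` alike.
  have hUb : ∀ ξ ∈ segment ℝ R.corner R.foot,
      inner ℝ (R.v ξ - w) R.nB = inner ℝ (R.U.v - w) R.nB := by
    intro ξ hξ
    have h1 := R.slip_foot hξ
    have h2 := R.inner_nB_corner hξ
    have h3 := R.slip_U R.lenB le_rfl
    rw [← R.foot_eq] at h3
    have h4 := R.inner_nB_corner hfootB
    unfold IsSlip at h3
    simp only [inner_sub_left] at *
    linarith
  have hvA : ∀ ξ ∈ segment ℝ R.corner R.refl,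
      inner ℝ (R.v ξ - w) R.nA = inner ℝ (R.v R.refl - w) R.nA := by
    intro ξ hξ
    have h1 := R.slip_A hξ
    have h2 := R.inner_nA_corner hξ
    have h3 := R.slip_A hreflA
    have h4 := R.inner_nA_corner hreflA
    simp only [inner_sub_left] at *
    linarith
  set ℓ := ConstState.through (R.ψ (R.σ 0)) w (R.σ 0) with hℓ
  have hℓv : ℓ.v = w := rfl
  obtain ⟨ξ₀, hξ₀, hmin⟩ := P.exists_frontier_min hγ ⟨R.refl, R.segment_A_subset hreflA⟩ ℓ hη
  have hdir := fun {d : Plane} => P.inner_nonneg_of_min (d := d) (frontier_subset_closure hξ₀) hmin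
  rw [hℓv] at hdir
  have hpoint_refl : ξ₀ ≠ R.refl := by
    rintro rfl
    have h1 := hdir (d := R.corner - R.refl) (eventually_mem_segment (by rwa [segment_symm]))
    have h2 : R.corner - R.refl = R.lenA • (-R.a) := by rw [R.refl_eq]; module
    rw [h2, inner_smul_right, mul_left_comm] at h1
    exact absurd h1 (not_le.2 (mul_neg_of_pos_of_neg R.lenA_pos hwa))
  have hpoint_corner : ξ₀ ≠ R.corner := by
    rintro rfl
    have hcA : R.corner ∈ segment ℝ R.corner R.refl := left_mem_segment ℝ _ _
    have hcB : R.corner ∈ segment ℝ R.corner R.foot := left_mem_segment ℝ _ _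
    have h1 := hdir (d := R.refl - R.corner) (eventually_mem_segment hKA)
    have h2 := hdir (d := R.foot - R.corner) (eventually_mem_segment hKB)
    have e1 : R.refl - R.corner = R.lenA • R.a := by rw [R.refl_eq]; module
    have e2 : R.foot - R.corner = R.lenB • R.b := by rw [R.foot_eq]; module
    rw [e1, inner_smul_right, mul_left_comm] at h1
    rw [e2, inner_smul_right, mul_left_comm] at h2
    have h1 := nonneg_of_mul_nonneg_right h1 R.lenA_pos
    have h2 := nonneg_of_mul_nonneg_right h2 R.lenB_pos
    rw [← hvA _ hcA] at hwA
    rw [← hUb _ hcB] at hwB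
    have hsm : ∀ m : Plane, η * inner ℝ (R.v R.corner - w) m
        = inner ℝ m (η • (R.v R.corner - w)) := fun m => by
      rw [inner_smul_right, real_inner_comm]
    rw [hsm] at h1 h2 hwA hwB
    set x := η • (R.v R.corner - w)
    -- Directions and normals exchange roles: nonnegative derivatives along both walls put `-x` into
    -- the cone of the outer normals, whereas `x` has positive products with both normals. This
    -- forces `x = 0`.
    obtain ⟨α, β, hα, hβ, hy⟩ := exists_cone_combination (a := R.nA) (b := R.nB) (nA := R.a)
      (nB := R.b) (y := -x) R.norm_nA R.norm_a (by rw [real_inner_comm]; exact R.nA_perp)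
      (by rw [real_inner_comm]; exact R.nB_perp) (by rw [real_inner_comm]; exact R.nB_outer)
      (by rw [real_inner_comm]; exact R.nA_outer) (by rw [inner_neg_right]; linarith)
      (by rw [inner_neg_right]; linarith)
    have h3 : inner ℝ (-x) x = α * inner ℝ R.nA x + β * inner ℝ R.nB x := by
      rw [hy, inner_add_left, inner_smul_left, inner_smul_left]; simp
    rw [inner_neg_left] at h3
    have h4 : inner ℝ x x ≤ 0 := by nlinarith
    rw [real_inner_self_nonpos.1 h4, inner_zero_right] at hwA
    exact lt_irrefl _ hwA
  have hpoint_foot : ξ₀ ≠ R.foot := by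
    rintro rfl
    have h1 := P.inner_nonpos_of_min_end hσ (ℓ := ℓ) (η := η) (by rwa [R.shock_end])
    obtain ⟨l, hl, hj⟩ := P.jump_eq hσ h1I
    rw [R.shock_end, hℓv] at h1
    rw [R.shock_end] at hj
    -- On `B` the states on both sides of the shock have the same normal velocity, so the shock
    -- meets `B` at a right angle. The end condition along the shock then becomes one on the normal
    -- component.
    have hn : inner ℝ (R.n 1) R.nB = 0 := by
      have h2 := hUb _ hfootB
      have h3 : inner ℝ (R.U.v - R.v R.foot) R.nB = 0 := by
        simp only [inner_sub_left] at h2 ⊢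
        linarith
      rw [hj, inner_smul_left, conj_trivial] at h3
      exact (mul_eq_zero.1 h3).resolve_left hl.ne'
    have hn1 := (P.shock 1 h1I).norm_normal
    have hperp := P.normal_perp 1 h1I
    have htne := P.shock_regular 1 h1I
    have hder := P.hasDerivWithinAt h1I
    set t := derivWithin R.σ (Icc 0 1) 1
    have ht := eq_smul_of_perp (x := t) R.norm_nB (norm_ne_zero_iff.1 (by rw [hn1]; norm_num))
      (by rw [real_inner_comm]; exact hn) (by rw [real_inner_comm]; exact hperp)
    have htpos : 0 ≤ inner ℝ t R.nB := by
      have h2 := hasDerivWithinAt_inner_curve hder R.nB R.corner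
      have hval : inner ℝ R.nB (R.σ 1 - R.corner) = 0 := by
        rw [R.shock_end, real_inner_comm]; exact R.inner_nB_corner hfootB
      rw [hasDerivWithinAt_iff_tendsto_slope] at h2
      have h3 := h2.mono_left (nhdsWithin_mono (1 : ℝ) (show Ioo (0 : ℝ) 1 ⊆ Icc 0 1 \ {1} from
        fun s hs => ⟨Ioo_subset_Icc_self hs, hs.2.ne⟩))
      have : (𝓝[Ioo (0 : ℝ) 1] 1).NeBot := right_nhdsWithin_Ioo_neBot one_pos
      rw [real_inner_comm]
      refine ge_of_tendsto h3 ?_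
      filter_upwards [self_mem_nhdsWithin] with s hs
      rw [slope_def_field, hval, sub_zero]
      exact div_nonneg_of_nonpos (R.shock_domain s hs).2.le (by linarith [hs.2])
    have htne' : inner ℝ t R.nB ≠ 0 := fun h => htne (by rw [ht, h, zero_smul])
    rw [ht, inner_smul_right, mul_left_comm, hUb _ hfootB] at h1
    exact absurd h1 (not_le.2 (mul_pos (lt_of_le_of_ne htpos htne'.symm) hwB))
  rw [R.frontier_E] at hξ₀
  rcases hξ₀ with (⟨s, hs, rfl⟩ | hA) | hB
  · rcases eq_endpoints_or_mem_Ioo_of_mem_Icc hs with rfl | rfl | hs'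
    · exact hpoint_refl R.shock_start
    · exact hpoint_foot R.shock_end
    · refine P.not_min_on_shock hγ hσ hη (by rwa [R.shock_start]) (fun h => ?_)
        (by rwa [R.shock_start]) hs' (fun h => ?_) hmin
      · rw [h, inner_zero_left, mul_zero] at hwB
        exact lt_irrefl _ hwB
      · obtain ⟨h1, h2, h3⟩ := hcone h
        obtain ⟨l, hl, hj⟩ := P.jump_eq hσ h0I
        rw [R.shock_start] at hj
        -- The point `U.v` lies on the line of `B` and beyond the line of `A`. Hence the vector from
        -- it to a point of the flow domain lies in the cone of the wall directions, on which `U.v -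
        -- w` is nonpositive.
        obtain ⟨α, β, hα, hβ, hy⟩ := exists_cone_combination (y := R.σ s - R.U.v) R.norm_a
          R.norm_nA R.nA_perp R.nB_perp R.nA_outer R.nB_outer (by
            have e1 := (R.shock_domain s hs').1
            have e2 := R.slip_A hreflA
            have e3 := R.inner_nA_corner hreflA
            have e4 : 0 < inner ℝ (R.U.v - R.v R.refl) R.nA := by
              rw [hj, inner_smul_left, conj_trivial]
              exact mul_pos hl h3
            rw [real_inner_comm] at e1 ⊢
            simp only [inner_sub_left] at *
            linarith) (by
            have e1 := (R.shock_domain s hs').2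
            have e2 := R.slip_U R.lenB le_rfl
            rw [← R.foot_eq] at e2
            have e3 := R.inner_nB_corner hfootB
            unfold IsSlip at e2
            rw [real_inner_comm] at e1 ⊢
            simp only [inner_sub_left] at *
            linarith)
        rw [hy, inner_add_right, inner_smul_right, inner_smul_right]
        nlinarith
  · by_cases hopen : ξ₀ ∈ openSegment ℝ R.corner R.refl
    · have h1 := hdir (R.eventually_mem_A hopen)
      rw [inner_neg_right, hvA _ hA] at h1
      linarith
    · rw [← insert_endpoints_openSegment] at hA
      rcases hA with h | h | h
      exacts [hpoint_corner h, hpoint_refl h, hopen h]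
  · by_cases hopen : ξ₀ ∈ openSegment ℝ R.corner R.foot
    · have h1 := hdir (R.eventually_mem_B hopen)
      rw [inner_neg_right, hUb _ hB] at h1
      linarith
    · rw [← insert_endpoints_openSegment] at hB
      rcases hB with h | h | h
      exacts [hpoint_corner h, hpoint_foot h, hopen h]

/-- No transonic reflected shock is strong-type. -/
theorem not_isStrongType (hγ : 1 ≤ γ) (hangle : R.angleB ≠ Real.pi / 2) : ¬ R.IsStrongType := by
  intro hst
  have h0I : (0 : ℝ) ∈ Icc (0 : ℝ) 1 := left_mem_Icc.2 zero_le_one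
  obtain ⟨l, hl, hj⟩ := R.patch.jump_eq R.mapsTo_shock h0I
  have hdown := (R.patch.shock 0 h0I).downstream
  have hpert := R.patch.exists_perturbation R.mapsTo_shock R.norm_nA R.nA_perp
  rw [R.shock_start] at hj hdown hpert
  obtain ⟨e, heA, hea, hg⟩ := hpert (R.slip_A (right_mem_segment ℝ _ _)) hst
  obtain ⟨hza, hna⟩ := R.directions
  have hκ : inner ℝ (R.U.v - R.v R.refl) R.nB ≠ 0 := fun h =>
    hangle (InnerProductGeometry.inner_eq_zero_iff_angle_eq_pi_div_two _ _ |>.1 h)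
  -- The angle hypothesis makes it possible to match the sign on `B`.
  obtain ⟨η, hη, hηκ⟩ : ∃ η : ℝ, (η = 1 ∨ η = -1) ∧
      0 < η * inner ℝ (R.U.v - R.v R.refl) R.nB := by
    rcases lt_or_gt_of_ne hκ with h | h
    · exact ⟨-1, Or.inr rfl, by linarith⟩
    · exact ⟨1, Or.inl rfl, by linarith⟩
  have hηη : η * η = 1 := by rcases hη with rfl | rfl <;> norm_num
  have hw : Tendsto (fun ε : ℝ => R.v R.refl + (η * ε) • e) (𝓝[>] 0) (𝓝 (R.v R.refl)) := by
    have hc : Continuous fun ε : ℝ => R.v R.refl + (η * ε) • e := by fun_prop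
    have h1 := hc.tendsto 0
    simp only [mul_zero, zero_smul, add_zero] at h1
    exact h1.mono_left nhdsWithin_le_nhds
  have hcont : ∀ f : Plane → ℝ, Continuous f → 0 < f (R.v R.refl) →
      ∀ᶠ ε in 𝓝[>] (0 : ℝ), 0 < f (R.v R.refl + (η * ε) • e) := fun f hf h =>
    ((hf.tendsto _).comp hw).eventually (lt_mem_nhds h)
  have c1 := hcont (fun w => η * inner ℝ (R.U.v - w) R.nB) (by fun_prop) hηκ
  have c2 := hcont (fun w => inner ℝ (R.U.v - w) (w - R.refl)) (by fun_prop) (by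
    beta_reduce
    rw [hj, inner_smul_left, conj_trivial, real_inner_comm]
    exact mul_pos hl hdown)
  have c3 : ∀ᶠ ε in 𝓝[>] (0 : ℝ), η = -1 →
      inner ℝ (R.U.v - (R.v R.refl + (η * ε) • e)) R.a < 0 ∧
      inner ℝ (R.U.v - (R.v R.refl + (η * ε) • e)) R.b < 0 ∧ 0 < inner ℝ (R.n 0) R.nA := by
    rcases hη with h | h
    · exact Eventually.of_forall fun ε h' => by rw [h] at h'; norm_num at h'
    · have hB : inner ℝ (R.n 0) R.nB < 0 := by
        rw [hj, inner_smul_left, conj_trivial, h] at hηκ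
        nlinarith
      filter_upwards [hcont (fun w => -inner ℝ (R.U.v - w) R.a) (by fun_prop) (by
          beta_reduce
          rw [hj, inner_smul_left, conj_trivial]
          nlinarith),
        hcont (fun w => -inner ℝ (R.U.v - w) R.b) (by fun_prop) (by
          beta_reduce
          rw [hj, inner_smul_left, conj_trivial]
          nlinarith [R.normal_side_b hB])] with ε h1 h2 _
      exact ⟨neg_pos.1 h1, neg_pos.1 h2, R.normal_side_A hB⟩
  obtain ⟨ε, h1, h2, h3, h4, h5⟩ :=
    (c1.and (c2.and (c3.and ((hg η hη).and (self_mem_nhdsWithin (s := Ioi (0 : ℝ))))))).exists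
  have h5 : 0 < ε := h5
  have hdiff : R.v R.refl - (R.v R.refl + (η * ε) • e) = -((η * ε) • e) := by abel
  refine R.not_min hγ hη h4 h2 ?_ ?_ h1 h3
  · rw [hdiff, inner_neg_neg, inner_smul_left, conj_trivial, hea, ← mul_assoc, ← mul_assoc, hηη,
      one_mul]
    exact mul_neg_of_pos_of_neg h5 hza
  · rw [hdiff, inner_neg_left, inner_smul_left, conj_trivial, mul_neg, ← mul_assoc, ← mul_assoc,
      hηη, one_mul]
    nlinarith

end ClassicalReflection

/-- An affine function does not attain its minimum over an arc of a circle in an interior point of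
the arc, if its gradient has a positive radial component there. -/
theorem not_min_on_arc {c y d : Plane} {S : Set Plane} (hd : 0 < inner ℝ d y)
    (hS : ∀ᶠ x in 𝓝 (c + y), ‖x - c‖ = ‖y‖ → x ∈ S)
    (hmin : ∀ x ∈ S, 0 ≤ inner ℝ d (x - (c + y))) : False := by
  set z : Plane := WithLp.toLp 2 ![-y 1, y 0] with hz
  have hyz : inner ℝ y z = 0 := by
    rw [plane_inner, hz]; simp; ring
  have hzz : ‖z‖ ^ 2 = ‖y‖ ^ 2 := by
    rw [← real_inner_self_eq_norm_sq, ← real_inner_self_eq_norm_sq, plane_inner, plane_inner, hz]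
    simp; ring
  have hnorm : ∀ θ : ℝ, ‖Real.cos θ • y + Real.sin θ • z‖ = ‖y‖ := by
    intro θ
    rw [← sq_eq_sq₀ (norm_nonneg _) (norm_nonneg _), norm_add_sq_real, norm_smul, norm_smul,
      inner_smul_left, inner_smul_right, hyz, mul_pow, mul_pow, hzz, Real.norm_eq_abs,
      Real.norm_eq_abs, sq_abs, sq_abs]
    linear_combination ‖y‖ ^ 2 * Real.sin_sq_add_cos_sq θ
  have hcont : Continuous fun θ : ℝ => c + (Real.cos θ • y + Real.sin θ • z) := by fun_prop
  have h0 := hcont.tendsto 0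
  have hcont' : Continuous fun θ : ℝ => c + (Real.cos (-θ) • y + Real.sin (-θ) • z) := by fun_prop
  have h0' := hcont'.tendsto 0
  simp only [Real.cos_zero, Real.sin_zero, one_smul, zero_smul, add_zero, neg_zero] at h0 h0'
  -- Rotation by `θ` and by `-θ`: on adding the two inequalities the sine terms cancel and `2 (cos θ
  -- - 1) d · y < 0` remains.
  obtain ⟨θ, ⟨h1, h2⟩, h3⟩ := ((((h0.eventually hS).and (h0'.eventually hS)).filter_mono
    nhdsWithin_le_nhds).and (Ioo_mem_nhdsGT (Real.pi_pos))).exists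
  have e1 := hmin _ (h1 (by rw [add_sub_cancel_left]; exact hnorm θ))
  have e2 := hmin _ (h2 (by rw [add_sub_cancel_left]; exact hnorm (-θ)))
  have hcos : Real.cos θ < 1 := by
    rw [← Real.cos_zero]
    exact Real.cos_lt_cos_of_nonneg_of_le_pi le_rfl h3.2.le h3.1
  rw [add_sub_add_left_eq_sub, inner_sub_right, inner_add_right, inner_smul_right,
    inner_smul_right] at e1 e2
  rw [Real.cos_neg, Real.sin_neg] at e2
  nlinarith

/-! ### Supersonic flow onto a wedge -/

namespace WedgeReflection

variable {γ : ℝ} {R : WedgeReflection γ}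

theorem IsFlow.segment_subset (F : R.IsFlow) : segment ℝ R.refl R.bottom ⊆ frontier R.E := by
  rw [F.frontier_E]
  exact fun x hx => Or.inl (Or.inr hx)

theorem IsFlow.arcP_subset (F : R.IsFlow) : R.arcP ⊆ frontier R.E := by
  rw [F.frontier_E]
  exact fun x hx => Or.inr hx

theorem IsFlow.mapsTo_shock (F : R.IsFlow) : MapsTo R.σ (Icc 0 1) (closure R.E) := fun s hs =>
  frontier_subset_closure (by rw [F.frontier_E]; exact Or.inl (Or.inl ⟨s, hs, rfl⟩))

theorem IsFlow.slip (F : R.IsFlow) {ξ : Plane} (hξ : ξ ∈ segment ℝ R.refl R.bottom) :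
    inner ℝ (R.v ξ - ξ) R.nA = 0 :=
  F.patch.slip_segment (F.segment_subset.trans frontier_subset_closure) F.patch.slip ξ hξ

theorem inner_nA_refl {ξ : Plane} (hξ : ξ ∈ segment ℝ R.refl R.bottom) :
    inner ℝ (ξ - R.refl) R.nA = 0 := by
  rw [R.bottom_eq] at hξ
  obtain ⟨x, -, -, rfl⟩ := exists_of_mem_segment R.len_pos hξ
  rw [add_sub_cancel_left, inner_smul_left, real_inner_comm, R.nA_perp, mul_zero]

theorem inner_nA_H : inner ℝ (R.H.v - R.refl) R.nA = 0 := by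
  have h1 := R.slip_H R.len le_rfl
  rw [← R.bottom_eq] at h1
  have h2 := R.inner_nA_refl (right_mem_segment ℝ _ _)
  unfold IsSlip at h1
  simp only [inner_sub_left] at *
  linarith

theorem inner_a_jump_H : inner ℝ (R.U.v - R.H.v) R.a = 0 := by
  have e0 := (R.shock_H 0 le_rfl).potential_eq
  have e1 := (R.shock_H 1 zero_le_one).potential_eq
  rw [zero_smul, add_zero] at e0
  simp only [ConstState.potential, inner_add_right, one_smul, inner_sub_left] at e0 e1 ⊢
  linarith

theorem IsFlow.directions (F : R.IsFlow) :
    0 < inner ℝ (R.v R.refl - R.refl) R.a ∧ 0 < inner ℝ (R.n 0) R.a := by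
  have h0I : (0 : ℝ) ∈ Icc (0 : ℝ) 1 := left_mem_Icc.2 zero_le_one
  obtain ⟨l, hl, hj⟩ := F.patch.jump_eq F.mapsTo_shock h0I
  have hdown := (F.patch.shock 0 h0I).downstream
  rw [R.shock_start] at hj hdown
  have hz := F.slip (left_mem_segment ℝ R.refl R.bottom)
  have e1 : R.U.v - R.refl = (R.v R.refl - R.refl) + l • R.n 0 := by rw [← hj]; abel
  have h1 := R.along_wedge
  rw [e1, real_inner_comm, inner_add_left, inner_smul_left, conj_trivial] at h1
  rw [plane_inner_eq R.norm_a R.norm_nA R.nA_perp, hz, zero_mul, add_zero] at hdown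
  rcases pos_and_pos_or_neg_and_neg_of_mul_pos hdown with h | h
  · exact h
  · nlinarith [h.1, h.2]

/-- A direction with positive radial component leaves the sonic disc at once. Used to transfer the
state `H` to the arc and to both of its endpoints. -/
theorem mem_closure_regionH {p d : Plane} (hp : ‖p - R.H.v‖ = R.H.sound γ)
    (ha : 0 < inner ℝ R.a (p - R.H.v)) (hd : 0 < inner ℝ (p - R.H.v) d)
    (h1 : ∀ᶠ t in 𝓝[>] (0 : ℝ), inner ℝ R.nA (p + t • d - R.refl) < 0)
    (h2 : ∀ᶠ t in 𝓝[>] (0 : ℝ), 0 < inner ℝ R.nA (p + t • d - R.top)) :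
    p ∈ closure R.regionH := by
  have hca : Continuous fun x : Plane => inner ℝ R.a (x - R.H.v) := by fun_prop
  refine mem_closure_of_tendsto (tendsto_add_smul p d) ?_
  filter_upwards [h1, h2, (tendsto_add_smul p d).eventually (hca.continuousAt.eventually
    (lt_mem_nhds ha)), self_mem_nhdsWithin] with t h1 h2 h3 h4
  have h4 : 0 < t := h4
  refine ⟨h1, h2, ?_, h3⟩
  rw [← hp]
  refine lt_of_pow_lt_pow_left₀ 2 (norm_nonneg _) ?_
  rw [add_sub_right_comm, norm_add_sq_real, inner_smul_right]
  have := mul_pos h4 hd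
  nlinarith [sq_nonneg ‖t • d‖]

theorem IsFlow.eq_H_of_mem_closure (F : R.IsFlow) {p : Plane} (hp : p ∈ closure R.regionH) :
    R.ψ p = R.H.potential p ∧ R.v p = R.H.v := by
  have hsub : closure R.regionH ⊆ closure (R.E ∪ R.regionH) := closure_mono subset_union_right
  have hψ : ContinuousOn R.ψ (closure R.regionH) := fun ξ hξ =>
    ((F.c1.1 ξ (hsub hξ)).hasFDerivWithinAt.continuousWithinAt).mono hsub
  have hpc : Continuous R.H.potential := by unfold ConstState.potential; fun_prop
  have e1 : EqOn R.ψ R.H.potential R.regionH := fun ξ hξ => (F.psi_H ξ hξ).1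
  have e2 : EqOn R.v (fun _ => R.H.v) R.regionH := fun ξ hξ => (F.psi_H ξ hξ).2
  exact ⟨e1.of_subset_closure hψ hpc.continuousOn subset_closure subset_rfl hp,
    e2.of_subset_closure (F.c1.2.mono hsub) continuousOn_const subset_closure subset_rfl hp⟩

theorem arcP_subset_closure : R.arcP ⊆ closure R.regionH := by
  rintro ξ ⟨h1, h2, h3, h4⟩
  refine R.mem_closure_regionH (d := R.a) h3 h4 (by rwa [real_inner_comm]) ?_ ?_ <;>
  · refine Eventually.of_forall fun t => ?_
    rw [add_sub_right_comm, inner_add_right, inner_smul_right, R.nA_perp, mul_zero, add_zero]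
    assumption

/-- At the endpoints of the arc the direction `a` runs along the edge of the strip containing
`regionH`; a small tilt leads inside and keeps the radial component positive. -/
theorem exists_direction {y : Plane} (hy : 0 < inner ℝ R.a y) (m : Plane) :
    ∃ δ : ℝ, 0 < inner ℝ y (R.a + δ • m) ∧ 0 < δ := by
  have hc : Continuous fun δ : ℝ => inner ℝ y (R.a + δ • m) := by fun_prop
  have h1 := (hc.tendsto 0).mono_left (nhdsWithin_le_nhds (s := Ioi 0))
  refine ((h1.eventually (lt_mem_nhds ?_)).and self_mem_nhdsWithin).exists
  rwa [zero_smul, add_zero, real_inner_comm]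

theorem eventually_inner_neg {x d m c : Plane} (h : inner ℝ m (x - c) < 0) :
    ∀ᶠ t in 𝓝[>] (0 : ℝ), inner ℝ m (x + t • d - c) < 0 := by
  have hc : Continuous fun x : Plane => inner ℝ m (x - c) := by fun_prop
  exact (tendsto_add_smul x d).eventually (hc.continuousAt.eventually (gt_mem_nhds h))

theorem top_mem_closure : R.top ∈ closure R.regionH := by
  obtain ⟨δ, h1, h2⟩ := R.exists_direction R.top_right R.nA
  refine R.mem_closure_regionH R.top_sonic R.top_right h1 (eventually_inner_neg R.top_domain) ?_
  filter_upwards [self_mem_nhdsWithin] with t ht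
  have ht : 0 < t := ht
  rw [add_sub_cancel_left, inner_smul_right, inner_add_right, inner_smul_right, R.nA_perp,
    real_inner_self_eq_norm_sq, R.norm_nA]
  positivity

theorem bottom_mem_closure : R.bottom ∈ closure R.regionH := by
  obtain ⟨δ, h1, h2⟩ := R.exists_direction R.bottom_right (-R.nA)
  have hb := R.inner_nA_refl (right_mem_segment ℝ R.refl R.bottom)
  rw [real_inner_comm] at hb
  refine R.mem_closure_regionH R.bottom_sonic R.bottom_right h1 ?_ ?_
  · filter_upwards [self_mem_nhdsWithin] with t ht
    have ht : 0 < t := ht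
    rw [add_sub_right_comm, inner_add_right, hb, inner_smul_right, inner_add_right,
      inner_smul_right, R.nA_perp, inner_neg_right, real_inner_self_eq_norm_sq, R.norm_nA]
    nlinarith [mul_pos ht h2]
  · have h3 : inner ℝ (-R.nA) (R.bottom - R.top) < 0 := by
      have h4 := R.top_domain
      rw [inner_neg_left]
      simp only [inner_sub_right] at *
      linarith
    filter_upwards [eventually_inner_neg (d := R.a + δ • -R.nA) h3] with t ht
    rwa [inner_neg_left, neg_lt_zero] at ht

/-- By slip the centre `H.v` lies on the wall line, so the circle meets that line in two opposite
points, and the sign selects one. -/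
theorem eq_bottom {x : Plane} (h1 : ‖x - R.H.v‖ = R.H.sound γ) (h2 : 0 ≤ inner ℝ R.a (x - R.H.v))
    (h3 : inner ℝ (x - R.refl) R.nA = 0) : x = R.bottom := by
  have hH := R.inner_nA_H
  have hb := R.inner_nA_refl (right_mem_segment ℝ R.refl R.bottom)
  have hn : ∀ y : Plane, inner ℝ (y - R.refl) R.nA = 0 → inner ℝ (y - R.H.v) R.nA = 0 := by
    intro y hy
    simp only [inner_sub_left] at *
    linarith
  have hsq : ∀ y : Plane, inner ℝ (y - R.refl) R.nA = 0 →
      inner ℝ (y - R.H.v) R.a ^ 2 = ‖y - R.H.v‖ ^ 2 := by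
    intro y hy
    rw [← real_inner_self_eq_norm_sq,
      plane_inner_eq R.norm_a R.norm_nA R.nA_perp (y - R.H.v) (y - R.H.v), hn y hy]
    ring
  have h4 : inner ℝ (x - R.H.v) R.a = inner ℝ (R.bottom - R.H.v) R.a := by
    have h5 := R.bottom_right
    rw [real_inner_comm] at h2 h5
    rw [← sq_eq_sq₀ h2 h5.le, hsq x h3, hsq _ hb, h1, R.bottom_sonic]
  have h6 := eq_of_inner_eq R.norm_a R.norm_nA R.nA_perp h4 (by rw [hn x h3, hn _ hb])
  exact sub_left_injective h6

theorem IsFlow.eventually_mem (F : R.IsFlow) {ξ : Plane}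
    (hξ : ξ ∈ openSegment ℝ R.refl R.bottom) :
    ∀ᶠ t in 𝓝[>] (0 : ℝ), ξ + t • (-R.nA) ∈ closure R.E := by
  have hseg := openSegment_subset_segment ℝ _ _ hξ
  have h1 := R.inner_nA_refl hseg
  have hopen := hξ
  rw [R.bottom_eq, mem_openSegment_iff_exists R.len_pos] at hopen
  obtain ⟨x, hx0, hxl, hx⟩ := hopen
  -- The arc `P` lacks its endpoints and is not closed; this closed half circle contains it and
  -- meets the wall line only at `bottom`.
  have hcl : IsClosed ({x : Plane | ‖x - R.H.v‖ = R.H.sound γ} ∩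
      {x : Plane | 0 ≤ inner ℝ R.a (x - R.H.v)}) := by
    refine IsClosed.inter (isClosed_eq ?_ continuous_const) (isClosed_le continuous_const ?_) <;>
    fun_prop
  have hσ : IsClosed (R.σ '' Icc 0 1) :=
    (isCompact_Icc.image_of_continuousOn F.patch.shock_c1.continuousOn).isClosed
  refine eventually_mem_of_frontier_subset (c := R.refl) (d := R.bottom) R.norm_nA F.patch.isOpen
    R.E_domain (frontier_subset_closure (F.segment_subset hseg)) (hσ.union hcl) ?_ ?_ ?_ hseg
  · rintro (⟨s, hs, hsξ⟩ | ⟨h2, h3⟩)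
    · rcases eq_endpoints_or_mem_Ioo_of_mem_Icc hs with rfl | rfl | hs'
      · rw [R.shock_start, hx, left_eq_add, smul_eq_zero] at hsξ
        rcases hsξ with h | h
        · exact hx0.ne' h
        · have := R.norm_a
          rw [h, norm_zero] at this
          exact zero_ne_one this
      · rw [← hsξ, R.shock_end, real_inner_comm] at h1
        exact R.top_domain.ne h1
      · rw [← hsξ, real_inner_comm] at h1
        exact (R.shock_domain s hs').ne h1
    · have h4 := R.eq_bottom h2 h3 h1
      rw [hx, R.bottom_eq, add_right_inj] at h4
      have h5 := congrArg (fun y => inner ℝ y R.a) h4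
      simp only [inner_smul_left, real_inner_self_eq_norm_sq, R.norm_a, conj_trivial] at h5
      linarith
  · rw [F.frontier_E]
    rintro x ((h | h) | h)
    exacts [Or.inl (Or.inl h), Or.inr h, Or.inl (Or.inr ⟨h.2.2.1, h.2.2.2.le⟩)]
  · rw [real_inner_comm]; exact R.inner_nA_refl (right_mem_segment ℝ _ _)

/-- There is no minimum on the wedge, the reflected shock and the sonic arc, for affine comparison
functions with suitable velocities `w`. -/
theorem IsFlow.not_min (hγ : 1 ≤ γ) (F : R.IsFlow) {w : Plane}
    (hg : 0 < 1 * shockFun γ R.U w R.refl) (hx : 0 < inner ℝ (R.U.v - w) (w - R.refl))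
    (hwa : inner ℝ (R.v R.refl - w) R.a < 0) (hwA : 0 < inner ℝ (R.v R.refl - w) R.nA)
    (hwH : 0 < inner ℝ (R.H.v - w) R.a) (hwt : 0 < inner ℝ (R.H.v - w) (R.top - R.H.v)) :
    False := by
  have h1I : (1 : ℝ) ∈ Icc (0 : ℝ) 1 := right_mem_Icc.2 zero_le_one
  have P := F.patch
  have hσ := F.mapsTo_shock
  have hrefl : R.refl ∈ segment ℝ R.refl R.bottom := left_mem_segment ℝ _ _
  have hK := F.segment_subset.trans frontier_subset_closure
  have hvA : ∀ ξ ∈ segment ℝ R.refl R.bottom,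
      inner ℝ (R.v ξ - w) R.nA = inner ℝ (R.v R.refl - w) R.nA := by
    intro ξ hξ
    have h1 := F.slip hξ
    have h2 := R.inner_nA_refl hξ
    have h3 := F.slip hrefl
    simp only [inner_sub_left] at *
    linarith
  set ℓ := ConstState.through (R.ψ (R.σ 0)) w (R.σ 0) with hℓ
  have hℓv : ℓ.v = w := rfl
  obtain ⟨ξ₀, hξ₀, hmin⟩ := P.exists_frontier_min hγ ⟨R.refl, F.segment_subset hrefl⟩ ℓ
    (Or.inl rfl)
  have hdir := fun {d : Plane} => P.inner_nonneg_of_min (d := d) (frontier_subset_closure hξ₀) hmin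
  rw [hℓv] at hdir
  have hbot : R.bottom - R.refl = R.len • R.a := by rw [R.bottom_eq]; module
  have hpoint_refl : ξ₀ ≠ R.refl := by
    rintro rfl
    have h1 := hdir (d := R.bottom - R.refl) (eventually_mem_segment hK)
    rw [hbot, inner_smul_right, one_mul] at h1
    exact absurd h1 (not_le.2 (mul_neg_of_pos_of_neg R.len_pos hwa))
  have hpoint_bottom : ξ₀ ≠ R.bottom := by
    rintro rfl
    have h1 := hdir (d := R.refl - R.bottom) (eventually_mem_segment (by rwa [segment_symm]))
    rw [← neg_sub R.bottom, hbot, inner_neg_right, inner_smul_right,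
      (F.eq_H_of_mem_closure R.bottom_mem_closure).2] at h1
    linarith [mul_pos R.len_pos hwH]
  -- The curved shock joins the straight one with tangent `a`, and the velocity at `top` is `H.v`.
  -- So the derivative on arrival is a positive multiple of `(H.v - w) · a > 0`.
  have hpoint_top : ξ₀ ≠ R.top := by
    rintro rfl
    have h1 := P.inner_nonpos_of_min_end hσ (ℓ := ℓ) (η := 1) (by rwa [R.shock_end])
    obtain ⟨r, hr, ht⟩ := R.shock_tangent
    rw [R.shock_end, hℓv, ht, inner_smul_right, (F.eq_H_of_mem_closure R.top_mem_closure).2] at h1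
    linarith [mul_pos hr hwH]
  rw [F.frontier_E] at hξ₀
  rcases hξ₀ with (⟨s, hs, rfl⟩ | hA) | hP
  · rcases eq_endpoints_or_mem_Ioo_of_mem_Icc hs with rfl | rfl | hs'
    · exact hpoint_refl R.shock_start
    · exact hpoint_top R.shock_end
    · refine P.not_min_on_shock hγ hσ (Or.inl rfl) (by rwa [R.shock_start]) (fun h => ?_)
        (by rwa [R.shock_start]) hs' (fun h => by norm_num at h) hmin
      have h1 := R.inner_a_jump_H
      rw [sub_eq_zero.1 h, inner_sub_left] at h1
      rw [inner_sub_left] at hwH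
      linarith
  · by_cases hopen : ξ₀ ∈ openSegment ℝ R.refl R.bottom
    · have h1 := hdir (F.eventually_mem hopen)
      rw [inner_neg_right, hvA _ hA] at h1
      linarith
    · rw [← insert_endpoints_openSegment] at hA
      rcases hA with h | h | h
      exacts [hpoint_refl h, hpoint_bottom h, hopen h]
  · obtain ⟨p1, p2, p3, p4⟩ := id hP
    have hexp := plane_inner_eq R.norm_a R.norm_nA R.nA_perp
    have hH := R.inner_nA_H
    have hdA : 0 < inner ℝ (R.H.v - w) R.nA := by
      have h3 := F.slip hrefl
      simp only [inner_sub_left] at *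
      linarith
    refine not_min_on_arc (c := R.H.v) (y := ξ₀ - R.H.v) (d := R.H.v - w) (S := R.arcP) ?_ ?_ ?_
    · have q1 : inner ℝ (ξ₀ - R.H.v) R.nA < 0 := by
        rw [real_inner_comm] at p1
        simp only [inner_sub_left] at *
        linarith
      have q2 : inner ℝ (R.top - R.H.v) R.nA < inner ℝ (ξ₀ - R.H.v) R.nA := by
        rw [real_inner_comm] at p2
        simp only [inner_sub_left] at *
        linarith
      have q3 : ‖ξ₀ - R.H.v‖ ^ 2 = ‖R.top - R.H.v‖ ^ 2 := by rw [p3, R.top_sonic]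
      rw [← real_inner_self_eq_norm_sq, ← real_inner_self_eq_norm_sq,
        hexp (ξ₀ - R.H.v) (ξ₀ - R.H.v), hexp (R.top - R.H.v) (R.top - R.H.v)] at q3
      have q4 := R.top_right
      rw [real_inner_comm] at p4 q4
      -- Going down the arc from `top`, both components of the radius vector are at least those at
      -- `top`. As `H.v - w` has positive components, its radial part stays positive along the whole
      -- arc.
      have q5 : inner ℝ (R.top - R.H.v) R.a ≤ inner ℝ (ξ₀ - R.H.v) R.a := by
        refine abs_le_of_sq_le_sq' ?_ p4.le |>.2
        nlinarith
      rw [hexp] at hwt ⊢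
      nlinarith
    · rw [add_sub_cancel]
      have hc1 : Continuous fun x : Plane => inner ℝ R.nA (x - R.refl) := by fun_prop
      have hc2 : Continuous fun x : Plane => inner ℝ R.nA (x - R.top) := by fun_prop
      have hc3 : Continuous fun x : Plane => inner ℝ R.a (x - R.H.v) := by fun_prop
      filter_upwards [hc1.continuousAt.eventually (gt_mem_nhds p1),
        hc2.continuousAt.eventually (lt_mem_nhds p2),
        hc3.continuousAt.eventually (lt_mem_nhds p4)] with x h1 h2 h3 h4
      exact ⟨h1, h2, h4.trans p3, h3⟩
    · intro x hxP
      have h1 := hmin x (frontier_subset_closure (F.arcP_subset hxP))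
      rw [(F.eq_H_of_mem_closure (R.arcP_subset_closure hP)).1,
        (F.eq_H_of_mem_closure (R.arcP_subset_closure hxP)).1, hℓ,
        ConstState.through_potential, ConstState.through_potential] at h1
      simp only [ConstState.potential, add_sub_cancel, inner_sub_left, inner_sub_right] at *
      linarith

/-- No transonic reflected shock is strong-type. -/
theorem IsFlow.not_isStrongType (hγ : 1 ≤ γ) (F : R.IsFlow) : ¬ R.IsStrongType := by
  intro hst
  have h0I : (0 : ℝ) ∈ Icc (0 : ℝ) 1 := left_mem_Icc.2 zero_le_one
  have hrefl : R.refl ∈ segment ℝ R.refl R.bottom := left_mem_segment ℝ _ _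
  obtain ⟨l, hl, hj⟩ := F.patch.jump_eq F.mapsTo_shock h0I
  have hdown := (F.patch.shock 0 h0I).downstream
  have hpert := F.patch.exists_perturbation F.mapsTo_shock R.norm_nA R.nA_perp
  rw [R.shock_start] at hj hdown hpert
  obtain ⟨e, heA, hea, hg⟩ := hpert (F.slip hrefl) hst
  obtain ⟨hza, hna⟩ := F.directions
  have hw : Tendsto (fun ε : ℝ => R.v R.refl + ((1 : ℝ) * ε) • e) (𝓝[>] 0) (𝓝 (R.v R.refl)) := by
    have hc : Continuous fun ε : ℝ => R.v R.refl + ((1 : ℝ) * ε) • e := by fun_prop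
    have h1 := hc.tendsto 0
    simp only [mul_zero, zero_smul, add_zero] at h1
    exact h1.mono_left nhdsWithin_le_nhds
  have hcont : ∀ f : Plane → ℝ, Continuous f → 0 < f (R.v R.refl) →
      ∀ᶠ ε in 𝓝[>] (0 : ℝ), 0 < f (R.v R.refl + ((1 : ℝ) * ε) • e) := fun f hf h =>
    ((hf.tendsto _).comp hw).eventually (lt_mem_nhds h)
  -- The straight shock is parallel to `a`, so `H.v` and `U.v` have the same component along the
  -- wedge. The difference is therefore the tangential part of the jump at the tip.
  have hκ : 0 < inner ℝ (R.H.v - R.v R.refl) R.a := by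
    have h1 := R.inner_a_jump_H
    have h2 : inner ℝ (R.U.v - R.v R.refl) R.a = l * inner ℝ (R.n 0) R.a := by
      rw [hj, inner_smul_left, conj_trivial]
    have h3 := mul_pos hl hna
    simp only [inner_sub_left] at *
    linarith
  have hκA : inner ℝ (R.H.v - R.v R.refl) R.nA = 0 := by
    have h1 := R.inner_nA_H
    have h2 := F.slip hrefl
    simp only [inner_sub_left] at *
    linarith
  have c1 := hcont (fun w => inner ℝ (R.H.v - w) R.a) (by fun_prop) hκ
  have c2 := hcont (fun w => inner ℝ (R.U.v - w) (w - R.refl)) (by fun_prop) (by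
    beta_reduce
    rw [hj, inner_smul_left, conj_trivial, real_inner_comm]
    exact mul_pos hl hdown)
  have c3 := hcont (fun w => inner ℝ (R.H.v - w) (R.top - R.H.v)) (by fun_prop) (by
    beta_reduce
    rw [plane_inner_eq R.norm_a R.norm_nA R.nA_perp, hκA, zero_mul, add_zero,
      real_inner_comm R.a (R.top - R.H.v)]
    exact mul_pos hκ R.top_right)
  obtain ⟨ε, h1, h2, h3, h4, h5⟩ := (c1.and (c2.and (c3.and
    ((hg 1 (Or.inl rfl)).and (self_mem_nhdsWithin (s := Ioi (0 : ℝ))))))).exists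
  have h5 : 0 < ε := h5
  have hdiff : R.v R.refl - (R.v R.refl + ((1 : ℝ) * ε) • e) = -(ε • e) := by
    rw [one_mul]; abel
  refine F.not_min hγ h4 h2 ?_ ?_ h1 h3
  · rw [hdiff, inner_neg_left, inner_smul_left, conj_trivial, hea]
    linarith [mul_pos h5 hza]
  · rw [hdiff, inner_neg_left, inner_smul_left, conj_trivial]
    nlinarith

end WedgeReflection

theorem mainTheorem1 (γ : ℝ) (hγ : 1 ≤ γ) :
    (∀ R : ClassicalReflection γ, R.angleB ≠ Real.pi / 2 → ¬ R.IsStrongType) ∧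
    (∀ R : WedgeReflection γ, R.IsFlow → ¬ R.IsStrongType) :=
  ⟨fun R h => R.not_isStrongType hγ h, fun _ F => F.not_isStrongType hγ⟩
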